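/- Setting. Let $\mathcal X$ be a measurable space, $\mathcal Y=\{-1,+1\}$, and let $\mathcal F$ be a set of measurable classifiers $f:\mathcal X\to\mathcal Y$ with finite VC dimension $d=\dim(\mathcal F)\ge 1$. For a distribution $\mathcal D$ on $\mathcal X\times\mathcal Y$ let $\mathrm{err}_{\mathcal D}(f)=\Pr_{(x,y)\sim\mathcal D}[y\ne f(x)]$, and for a finite sample $S$ let $\mathrm{err}_S(f)$ be the fraction of examples in $S$ that $f$ misclassifies. An oracle $\mathcal O_{\mathcal F}$ for the realizable setting maps a sample $S$ to some $f\in\mathcal F$ with $\mathrm{err}_S(f)=0$ if one exists, and to "none" otherwise; its answer is assumed to depend measurably on the sample, in the sense that $(S,x)\mapsto\mathcal O_{\mathcal F}(S)(x)$ is jointly measurable. For $\epsilon,\delta\in(0,1)$ call $m\in\mathbb N$ a realizable sample size for $(\mathcal F,\epsilon,\delta)$ if, for every distribution $\mathcal D$ for which some $f^*\in\mathcal F$ has $\mathrm{err}_{\mathcal D}(f^*)=0$, with probability at least $1-\delta$ over $S\sim\mathcal D^m$ every $f\in\mathcal F$ that classifies $S$ perfectly has $\mathrm{err}_{\mathcal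 D}(f)\le\epsilon$. Write $R(d,\epsilon,\delta)=\frac1\epsilon\bigl(d\ln\frac1\epsilon+\ln\frac1\delta\bigr)$. Algorithm with parameters $\epsilon,\delta\in(0,1)$, $C>0$, and a realizable sample size $m$ for $(\mathcal F,\epsilon/4,1/2)$: (1) let $r=\lceil m^2\ln(2/\delta)\rceil$; (2) for $i=1,\dots,r$ draw a sample $S_i$ of $m$ i.i.d. examples from $\mathcal D$ and let $f_i=\mathcal O_{\mathcal F}(S_i)$; (3) draw a fresh sample $S$ of $m'=\lceil\frac{C}{\epsilon}\ln(r/\delta)\rceil$ i.i.d. examples from $\mathcal D$; (4) return an $f_i\ne$ "none" of minimum $\mathrm{err}_S(f_i)$, ties being broken arbitrarily. Theorem (Kearns–Li). (a) There is an absolute constant $K_0$ such that for all $\epsilon\in(0,1)$ and every $\mathcal F$ as above which is well behaved (that is, for all $n$ and $b\in\mathcal Y^n$, the set $\{x\in\mathcal X^n:\exists f\in\mathcal F\ \forall i\ f(x_i)=b_i\}$ is measurable up to null sets with respect to $\mu^n$ for every probability measure $\mu$ on $\mathcal X$), there is a realizable sample size $m\le K_0\,R(d,\epsilon/4,1/2)$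 for $(\mathcal F,\epsilon/4,1/2)$. (b) There is an absolute constant $C_0$ such that for every $K$ there are a constant $c>0$ and a polynomial $P$ in three variables, both depending only on $K$, for which the following holds for all $\mathcal X$, $\mathcal F$, $\mathcal D$, $\mathcal O_{\mathcal F}$ as above, all $\epsilon,\delta\in(0,1)$, all $C\ge C_0$, and every realizable sample size $m\le K\,R(d,\epsilon/4,1/2)$ for $(\mathcal F,\epsilon/4,1/2)$. If some $f^*\in\mathcal F$ has $\mathrm{err}_{\mathcal D}(f^*)\le c\,\epsilon/\dim(\mathcal F)$, then the algorithm always makes at most $P\bigl(\dim(\mathcal F),\frac1\epsilon,\ln\frac1\delta\bigr)$ calls to $\mathcal O_{\mathcal F}$, and with probability at least $1-\delta$ it returns a classifier $f$ with $\mathrm{err}_{\mathcal D}(f)\le\epsilon$. -/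

import Mathlib

open MeasureTheory

universe u

noncomputable section

namespace SmallNoise

variable {X : Type u}

/-- A labelled instance. The two labels `-1` and `+1` are `false` and `true`. -/
abbrev Example (X : Type u) : Type u := X × Bool

/-- A classifier on the instance space `X`. -/
abbrev Classifier (X : Type u) : Type u := X → Bool

/-! ### VC dimension -/

/-- `T` can be labelled in all possible ways by classifiers of `F`. -/
def Shatters (F : Set (Classifier X)) (T : Finset X) : Prop :=
  ∀ b : X → Bool, ∃ f ∈ F, ∀ x ∈ T, f x = b x

/-- The VC dimension: the supremum of the sizes of the finite sets shattered by `F`. -/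
def vcDim (F : Set (Classifier X)) : ℕ∞ :=
  ⨆ (T : Finset X) (_ : Shatters F T), (T.card : ℕ∞)

/-! ### Errors -/

/-- The expected error `Pr_{(x,y) ∼ D} [y ≠ f x]`. -/
def err [MeasurableSpace X] (D : Measure (Example X)) (f : Classifier X) : ℝ :=
  D.real {z | z.2 ≠ f z.1}

/-- The empirical error of `f` on a finite sample with repetitions. -/
def empErr (S : List (Example X)) (f : Classifier X) : ℝ :=
  (S.countP (fun z => z.2 ≠ f z.1) : ℝ) / (S.length : ℝ)

/-- `f` classifies every example of `S` correctly. -/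
def Perfect (S : List (Example X)) (f : Classifier X) : Prop :=
  ∀ z ∈ S, f z.1 = z.2

/-- The law of `n` i.i.d. samples from `D`. -/
def iid [MeasurableSpace X] (D : Measure (Example X)) (n : ℕ) : Measure (Fin n → Example X) :=
  Measure.pi fun _ => D

/-! ### Sample size in the realizable setting -/

/-- `m` samples suffice for accuracy `ε` and confidence `1 - δ` in the realizable setting:
for every distribution `D` that some member of `F` labels without error, with probability at least
`1 - δ` over `S ∼ D^m`, each `f ∈ F` that is perfect on `S` has error at most `ε`.
The measure of a set that is not measurable is its outer measure, so this bounds the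
outer probability of the failure event. -/
def IsRealizableSampleSize [MeasurableSpace X] (F : Set (Classifier X)) (ε δ : ℝ) (m : ℕ) : Prop :=
  ∀ D : Measure (Example X), IsProbabilityMeasure D → (∃ f ∈ F, err D f = 0) →
    iid D m {S | ¬ ∀ f ∈ F, Perfect (List.ofFn S) f → err D f ≤ ε} ≤ ENNReal.ofReal δ

/-- The order `(1/ε) (d ln (1/ε) + ln (1/δ))` of the realizable sample complexity. -/
def realizableRate (d : ℕ) (ε δ : ℝ) : ℝ :=
  1 / ε * (d * Real.log (1 / ε) + Real.log (1 / δ))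

/-- The usual measurability convention for an uncountable class: its members are measurable, and,
for every labelling of `n` points, the set of `n`-tuples to which `F` can give
this labelling is measurable up to null sets of every product distribution. -/
def WellBehaved [MeasurableSpace X] (F : Set (Classifier X)) : Prop :=
  (∀ f ∈ F, Measurable f) ∧
  ∀ (n : ℕ) (b : Fin n → Bool) (μ : Measure X), IsProbabilityMeasure μ →
    NullMeasurableSet {x : Fin n → X | ∃ f ∈ F, ∀ i, f (x i) = b i} (Measure.pi fun _ => μ)

/-! ### The realizable oracle -/

/-- `O` is an oracle for the realizable setting: on a sample it returns a member of `F` that is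
perfect on it if there is one, and `none` otherwise. -/
structure IsRealizableOracle (F : Set (Classifier X))
    (O : List (Example X) → Option (Classifier X)) : Prop where
  sound : ∀ S f, O S = some f → f ∈ F ∧ Perfect S f
  complete : ∀ S, (∃ f ∈ F, Perfect S f) → O S ≠ none

/-- The answer of the oracle depends measurably on the sample: for every sample size and every
label, the set of pairs of a sample and an instance to which the returned classifier
gives that label is measurable. -/
def MeasurableOracle [MeasurableSpace X] (O : List (Example X) → Option (Classifier X)) : Prop :=
  ∀ (n : ℕ) (y : Bool),
    MeasurableSet {p : (Fin n → Example X) × X | ∃ f, O (List.ofFn p.1) = some f ∧ f p.2 = y}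

/-! ### Programs that call an oracle -/

/-- A program with result in `R` that may call an oracle with queries in `Q` and answers in `A`. -/
inductive OracleProg (Q A : Type u) (R : Type u) : Type u
  | ret : R → OracleProg Q A R
  | call : Q → (A → OracleProg Q A R) → OracleProg Q A R

namespace OracleProg

variable {Q A R : Type u}

/-- The result of a program when its calls are answered by `O`. -/
def result (O : Q → A) : OracleProg Q A R → R
  | ret a => a
  | call q k => result O (k (O q))

/-- The number of oracle calls of a program when its calls are answered by `O`. -/
def calls (O : Q → A) : OracleProg Q A R → ℕ
  | ret _ => 0
  | call q k => calls O (k (O q)) + 1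

/-- Make the listed queries one after the other, then continue with the list of
the answers, where `acc` holds the earlier answers in reverse order. -/
def callAll (k : List A → OracleProg Q A R) : List Q → List A → OracleProg Q A R
  | [], acc => k acc.reverse
  | q :: qs, acc => call q fun a => callAll k qs (a :: acc)

end OracleProg

/-! ### The algorithm -/

/-- The possible outputs of the selection step: the returned classifiers with
minimum empirical error on `S`. All ways of breaking ties are included. -/
def minimizers (S : List (Example X)) (answers : List (Option (Classifier X))) :
    Set (Classifier X) :=
  {f | some f ∈ answers ∧ ∀ g, some g ∈ answers → empErr S f ≤ empErr S g}

/-- Call the oracle on each of the samples in `train`, then choose by empirical error on `S`. -/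
def learner (train : List (List (Example X))) (S : List (Example X)) :
    OracleProg (List (Example X)) (Option (Classifier X)) (Set (Classifier X)) :=
  OracleProg.callAll (fun answers => .ret (minimizers S answers)) train []

/-- The number of rounds, `r = m² ln (2/δ)`, rounded up. -/
def rounds (m : ℕ) (δ : ℝ) : ℕ := ⌈(m : ℝ) ^ 2 * Real.log (2 / δ)⌉₊

/-- The size of the fresh sample, `m' = (C/ε) ln (r/δ)`, rounded up. -/
def freshSize (C ε δ : ℝ) (r : ℕ) : ℕ := ⌈C / ε * Real.log (r / δ)⌉₊

/-- All samples drawn in one run: `r` samples of size `m`, and a fresh one of size `n`. -/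
abbrev Draw (X : Type u) (r m n : ℕ) : Type u :=
  (Fin r → Fin m → Example X) × (Fin n → Example X)

/-- The law of these samples, all of them independent. -/
def drawLaw [MeasurableSpace X] (D : Measure (Example X)) (r m n : ℕ) : Measure (Draw X r m n) :=
  (Measure.pi fun _ : Fin r => iid D m).prod (iid D n)

/-- The program that the algorithm runs on the samples `ω`. -/
def algorithm {r m n : ℕ} (ω : Draw X r m n) :
    OracleProg (List (Example X)) (Option (Classifier X)) (Set (Classifier X)) :=
  learner (List.ofFn fun i => List.ofFn (ω.1 i)) (List.ofFn ω.2)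

/-- The run on `ω` succeeds: a classifier is returned, and, however ties are broken, its
error is at most `ε`. -/
def Succeeds [MeasurableSpace X] (D : Measure (Example X))
    (O : List (Example X) → Option (Classifier X)) (ε : ℝ) {r m n : ℕ} (ω : Draw X r m n) : Prop :=
  ((algorithm ω).result O).Nonempty ∧ ∀ f ∈ (algorithm ω).result O, err D f ≤ ε

end SmallNoise

end

noncomputable section

namespace SmallNoise

/-! ### Chernoff bounds -/

/-! Part (a) is the double-sample argument. If a member of `F` agrees with the target `g` on the
sample but has error above `e = ε/4`, then with probability at least 1/2 a second sample shows at
least `e * m / 2` disagreements (`measure_agree_le`, `two_inv_le_measure_hits`). The law of the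
double sample is invariant under swaps within pairs, and a fixed disagreement pattern is bad for at
most a fraction `2⁻ᵏ` of the swaps (`card_swaps_mul_two_pow_le`). Sauer–Shelah bounds the number of
patterns (`card_traces_mul_pow_le`), and averaging gives `measureReal_doubleBad_le`.

Part (b) rests on the chance that a whole training sample is free of noise. Let `η` be the error of
a good `g ∈ F`. Conditioned on agreement with `g`, the sample is i.i.d. from a realizable law, so
with probability at least 1/2 the oracle's answer has conditional error at most `ε/4`, hence error
at most `ε/4 + η ≤ ε/2` (`le_measureReal_goodSamples`). Agreement has probability `(1 - η)^m ≥ exp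
(-2ηm) ≥ 1/m`, because `η ≲ ε/d` and `m ≲ (d/ε) ln (1/ε)` keep `ηm` below a multiple of `ln m`
(`two_mul_err_mul_le_log`). A round therefore succeeds with probability at least `1/(2m) ≥ 1/m²` for
`m ≥ 2`, and about `m² ln (2/δ)` rounds contain a success except with probability `δ/2`.

The fresh sample is independent of the answers, so Chernoff bounds at the threshold `3ε/4` separate
errors above `ε` from errors at most `ε/2`, and a union bound over the answers costs another `δ/2`.
The degenerate values `m = 0, 1` and `r = 1` escape these estimates; a two-point distribution deals
with the former (`IsRealizableSampleSize.two_point`), while for `r = 1` there is nothing to select.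
-/

open Classical in
/-- The number of coordinates of `z` that lie in `B`. -/
def hits {ι Z : Type*} [Fintype ι] (B : Set Z) (z : ι → Z) : ℕ :=
  (Finset.univ.filter fun j => z j ∈ B).card

open Classical in
lemma pow_hits {ι Z : Type*} [Fintype ι] (B : Set Z) (z : ι → Z) (s : ℝ) :
    s ^ hits B z = ∏ j, if z j ∈ B then s else 1 := by
  rw [Finset.prod_ite]
  simp [hits]

lemma measurable_hits {ι Z Ω : Type*} [Fintype ι] [MeasurableSpace Ω]
    (B : Set Z) (z : Ω → ι → Z) (h : ∀ j, MeasurableSet {ω | z ω j ∈ B}) :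
    Measurable fun ω => hits B (z ω) := by
  classical
  simp only [hits, Finset.card_filter]
  exact Finset.measurable_sum _ fun j _ => Measurable.ite (h j) measurable_const measurable_const

section Chernoff

variable {ι Z : Type*} [Fintype ι] [MeasurableSpace Z] (D : Measure Z) [IsProbabilityMeasure D]
  {B : Set Z}

/-- By independence the exponential moment is a power of `1 + D(B)(s - 1)`, which is at most an
exponential. Values `s ≤ 1` serve the lower tail and `s ≥ 1` the upper one. -/
lemma integral_pow_hits_le (hB : MeasurableSet B) {s : ℝ} (hs : 0 < s) :
    ∫ z : ι → Z, s ^ hits B z ∂(Measure.pi fun _ => D) ≤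
      Real.exp (Fintype.card ι * D.real B * (s - 1)) := by
  classical
  simp only [pow_hits]
  rw [integral_fintype_prod_eq_pow (ι := ι) (fun x : Z => if x ∈ B then s else 1)]
  have h1 : ∫ x, (if x ∈ B then s else 1) ∂D = 1 + D.real B * (s - 1) := by
    have : (fun x => if x ∈ B then s else (1 : ℝ)) =
        fun x => 1 + B.indicator (fun _ => s - 1) x := by
      ext x; by_cases h : x ∈ B <;> simp [h]
    rw [this, integral_add (integrable_const _) ((integrable_const _).indicator hB),
      integral_indicator_const _ hB]
    simp
  rw [h1, mul_assoc, Real.exp_nat_mul]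
  refine pow_le_pow_left₀ ?_ (by linarith [Real.add_one_le_exp (D.real B * (s - 1))]) _
  have := measureReal_le_one (μ := D) (s := B)
  have : 0 ≤ D.real B := measureReal_nonneg
  nlinarith

lemma measureReal_le_pow_hits (hB : MeasurableSet B) {s : ℝ} (hs : 0 < s) (b : ℝ) :
    (Measure.pi fun _ : ι => D).real {z | Real.exp b ≤ s ^ hits B z} ≤
      Real.exp (Fintype.card ι * D.real B * (s - 1) - b) := by
  have hm : Measurable fun z : ι → Z => s ^ hits B z :=
    (measurable_from_nat (f := fun k => s ^ k)).comp
      (measurable_hits B id fun j => measurable_pi_apply j hB)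
  have hint : Integrable (fun z : ι → Z => s ^ hits B z) (Measure.pi fun _ => D) := by
    refine Integrable.of_bound hm.aestronglyMeasurable ((max s 1) ^ Fintype.card ι)
      (Filter.Eventually.of_forall fun z => ?_)
    rw [Real.norm_of_nonneg (by positivity)]
    refine (pow_le_pow_left₀ hs.le (le_max_left _ _) _).trans
      (pow_le_pow_right₀ (le_max_right _ _) ?_)
    exact Finset.card_le_univ _
  have := (mul_meas_ge_le_integral_of_nonneg
    (Filter.Eventually.of_forall fun z => by positivity) hint (Real.exp b)).trans
    (integral_pow_hits_le D hB hs)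
  rw [Real.exp_sub, le_div_iff₀ (Real.exp_pos b), mul_comm]
  exact this

/-- Lower tail of the number of hits. -/
lemma measureReal_hits_le (hB : MeasurableSet B) {s : ℝ} (hs : 0 < s) (hs1 : s ≤ 1) {p : ℝ}
    (hp : p ≤ D.real B) (t : ℝ) :
    (Measure.pi fun _ : ι => D).real {z | (hits B z : ℝ) ≤ t} ≤
      Real.exp (Fintype.card ι * p * (s - 1) - t * Real.log s) := by
  refine (measureReal_mono ?_ (measure_ne_top _ _)).trans
    ((measureReal_le_pow_hits D hB hs (t * Real.log s)).trans (Real.exp_le_exp.2 ?_))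
  · intro z hz
    rw [Set.mem_ofPred_eq] at hz ⊢
    rw [← Real.exp_log (pow_pos hs _), Real.log_pow]
    exact Real.exp_le_exp.2 (mul_le_mul_of_nonpos_right hz (Real.log_nonpos hs.le hs1))
  · have : (Fintype.card ι : ℝ) * p ≤ Fintype.card ι * D.real B := by gcongr
    nlinarith

/-- Upper tail of the number of hits. -/
lemma measureReal_le_hits (hB : MeasurableSet B) {s : ℝ} (hs1 : 1 ≤ s) {p : ℝ}
    (hp : D.real B ≤ p) (t : ℝ) :
    (Measure.pi fun _ : ι => D).real {z | t ≤ (hits B z : ℝ)} ≤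
      Real.exp (Fintype.card ι * p * (s - 1) - t * Real.log s) := by
  have hs : 0 < s := by linarith
  refine (measureReal_mono ?_ (measure_ne_top _ _)).trans
    ((measureReal_le_pow_hits D hB hs (t * Real.log s)).trans (Real.exp_le_exp.2 ?_))
  · intro z hz
    rw [Set.mem_ofPred_eq] at hz ⊢
    rw [← Real.exp_log (pow_pos hs _), Real.log_pow]
    exact Real.exp_le_exp.2 (mul_le_mul_of_nonneg_right hz (Real.log_nonneg hs1))
  · have : (Fintype.card ι : ℝ) * D.real B ≤ Fintype.card ι * p := by gcongr
    nlinarith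

end Chernoff

/-! ### The growth function -/

/-- The set of indices at which `f` and `g` disagree on the points `x`. -/
def disagreement {ι X : Type*} [Fintype ι] (f g : X → Bool) (x : ι → X) : Finset ι :=
  Finset.univ.filter fun j => f (x j) ≠ g (x j)

open Classical in
/-- The sets of indices at which members of `F` disagree with `g` on the points `x`. -/
def traces {ι : Type*} {X : Type u} [Fintype ι] (F : Set (Classifier X)) (g : Classifier X)
    (x : ι → X) : Finset (Finset ι) :=
  Finset.univ.filter fun E => ∃ f ∈ F, disagreement f g x = E

lemma card_le_of_vcDim {X : Type u} {F : Set (Classifier X)} {d : ℕ} (hd : vcDim F = d)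
    {T : Finset X} (hT : Shatters F T) : T.card ≤ d := by
  have : (T.card : ℕ∞) ≤ d := hd ▸ le_iSup₂ (f := fun (T : Finset X) (_ : Shatters F T) =>
    (T.card : ℕ∞)) T hT
  exact_mod_cast this

open Classical in
-- Taking disagreement with `g` only flips labels, so it preserves shattering. The points of a
-- shattered index set are distinct, since equal points cannot be told apart by the trace `{i}`.
lemma card_le_of_traces_shatters {ι : Type*} {X : Type u} [Fintype ι]
    {F : Set (Classifier X)} {d : ℕ} (hd : vcDim F = d) (g : Classifier X) (x : ι → X)
    {T : Finset ι} (hT : (traces F g x).Shatters T) : T.card ≤ d := by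
  have key : ∀ U ⊆ T, ∃ f ∈ F, ∀ j ∈ T, (f (x j) ≠ g (x j) ↔ j ∈ U) := by
    intro U hU
    obtain ⟨E, hE, hTE⟩ := hT hU
    obtain ⟨f, hf, rfl⟩ := (Finset.mem_filter.1 hE).2
    refine ⟨f, hf, fun j hj => ?_⟩
    rw [← hTE]
    simp [disagreement, hj]
  have hinj : Set.InjOn x T := by
    intro i hi j hj hij
    by_contra hne
    obtain ⟨f, -, hf⟩ := key {i} (by simpa using hi)
    have h1 := (hf i hi).2 (by simp)
    rw [hij] at h1
    have := (hf j hj).1 h1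
    exact hne (Finset.mem_singleton.1 this).symm
  rw [← Finset.card_image_of_injOn hinj]
  refine card_le_of_vcDim hd fun b => ?_
  obtain ⟨f, hfF, hf⟩ := key (T.filter fun j => b (x j) ≠ g (x j)) (Finset.filter_subset _ _)
  refine ⟨f, hfF, fun y hy => ?_⟩
  obtain ⟨j, hj, rfl⟩ := Finset.mem_image.1 hy
  have := hf j hj
  simp only [Finset.mem_filter, hj, true_and] at this
  revert this
  cases f (x j) <;> cases b (x j) <;> cases g (x j) <;> simp

/-- In the binomial expansion of `(1 + t)^N` keep the terms with `k ≤ d`, where `t^d ≤ t^k`. -/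
lemma sum_choose_mul_pow_le (N d : ℕ) {t : ℝ} (ht : 0 < t) (ht1 : t ≤ 1) :
    (∑ k ∈ Finset.Iic d, (N.choose k : ℝ)) * t ^ d ≤ (1 + t) ^ N := by
  have h1 : (1 + t) ^ N = ∑ k ∈ Finset.range (N + 1), (N.choose k : ℝ) * t ^ k := by
    rw [add_comm, add_pow]
    exact Finset.sum_congr rfl fun k _ => by ring
  -- The union covers the case `d > N`; the added coefficients vanish.
  have h2 : ∑ k ∈ Finset.range (N + 1), (N.choose k : ℝ) * t ^ k =
      ∑ k ∈ Finset.range (N + 1) ∪ Finset.Iic d, (N.choose k : ℝ) * t ^ k := by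
    refine Finset.sum_subset Finset.subset_union_left fun k _ hk => ?_
    rw [Nat.choose_eq_zero_of_lt (by simpa using hk)]
    simp
  rw [h1, h2, Finset.sum_mul]
  refine le_trans (Finset.sum_le_sum fun k hk => ?_)
    (Finset.sum_le_sum_of_subset_of_nonneg Finset.subset_union_right fun k _ _ => by positivity)
  exact mul_le_mul_of_nonneg_left (pow_le_pow_of_le_one ht.le ht1 (Finset.mem_Iic.1 hk))
    (by positivity)

/-- The Sauer–Shelah bound in exponential form. -/
lemma card_traces_mul_pow_le {ι : Type*} {X : Type u} [Fintype ι]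
    {F : Set (Classifier X)} {d : ℕ} (hd : vcDim F = d) (g : Classifier X) (x : ι → X)
    {t : ℝ} (ht : 0 < t) (ht1 : t ≤ 1) :
    ((traces F g x).card : ℝ) * t ^ d ≤ (1 + t) ^ Fintype.card ι := by
  classical
  refine le_trans ?_ (sum_choose_mul_pow_le (Fintype.card ι) d ht ht1)
  gcongr
  have h1 := ((traces F g x).card_le_card_shatterer).trans Finset.card_shatterer_le_sum_vcDim
  have h2 : (traces F g x).vcDim ≤ d := by
    refine Finset.sup_le fun T hT => ?_
    exact card_le_of_traces_shatters hd g x (Finset.mem_shatterer.1 hT)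
  have h3 := h1.trans (Finset.sum_le_sum_of_subset
    (f := fun k => (Fintype.card ι).choose k) (Finset.Iic_subset_Iic.2 h2))
  exact_mod_cast h3

/-! ### Random swaps -/

/-- Exchange the two points of each pair `i` with `σ i = true`. -/
def swap {ι : Type*} (σ : ι → Bool) : Bool × ι ≃ Bool × ι where
  toFun p := (p.1 ^^ σ p.2, p.2)
  invFun p := (p.1 ^^ σ p.2, p.2)
  left_inv p := by simp
  right_inv p := by simp

open Classical in
/-- The swaps after which a given set `E` avoids the first half, while it meets the second
half in at least `k` points. -/
lemma card_swaps_mul_two_pow_le {ι : Type*} [Fintype ι] (E : Finset (Bool × ι)) (k : ℕ) :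
    (Finset.univ.filter fun σ : ι → Bool => (∀ i, (σ i, i) ∉ E) ∧
      k ≤ (Finset.univ.filter fun i => (!σ i, i) ∈ E).card).card * 2 ^ k ≤
      2 ^ Fintype.card ι := by
  -- The two weights of a pair sum to at most 2, and a swap counted on the left has total weight at
  -- least `2 ^ k`. Expanding the product of the sums compares the two.
  let w : ι → Bool → ℕ := fun i b => if (b, i) ∈ E then 0 else if (!b, i) ∈ E then 2 else 1
  have h1 : ∏ i, ∑ b, w i b ≤ 2 ^ Fintype.card ι := by
    rw [← Finset.card_univ]
    refine Finset.prod_le_pow_card _ _ _ fun i _ => ?_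
    simp only [w, Fintype.sum_bool, Bool.not_true, Bool.not_false]
    split_ifs <;> norm_num
  rw [Finset.prod_univ_sum, Fintype.piFinset_univ] at h1
  refine le_trans ?_ h1
  rw [← smul_eq_mul, ← Finset.sum_const]
  refine le_trans (Finset.sum_le_sum fun σ hσ => ?_)
    (Finset.sum_le_sum_of_subset (Finset.filter_subset _ _))
  obtain ⟨h2, h3⟩ := (Finset.mem_filter.1 hσ).2
  have h4 : ∏ i, w i (σ i) = ∏ i, if (!σ i, i) ∈ E then 2 else 1 :=
    Finset.prod_congr rfl fun i _ => by simp [w, h2 i]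
  rw [h4, Finset.prod_ite, Finset.prod_const, Finset.prod_const_one, mul_one]
  exact Nat.pow_le_pow_right (by norm_num) h3

lemma measurePreserving_comp_equiv {ι κ X : Type*} [Fintype ι] [Fintype κ] [MeasurableSpace X]
    (μ : Measure X) [IsProbabilityMeasure μ] (e : ι ≃ κ) :
    MeasurePreserving (fun x : κ → X => x ∘ e) (Measure.pi fun _ => μ) (Measure.pi fun _ => μ) := by
  have hm : Measurable fun x : κ → X => x ∘ e :=
    measurable_pi_lambda _ fun i => measurable_pi_apply _
  refine ⟨hm, (Measure.pi_eq fun s hs => ?_).symm⟩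
  rw [Measure.map_apply hm (MeasurableSet.univ_pi hs)]
  have : (fun x : κ → X => x ∘ e) ⁻¹' Set.univ.pi s = Set.univ.pi fun k => s (e.symm k) := by
    ext x
    simp only [Set.mem_preimage, Set.mem_univ_pi, Function.comp]
    exact ⟨fun h k => by simpa using h (e.symm k), fun h i => by simpa using h (e i)⟩
  rw [this, Measure.pi_pi]
  exact Fintype.prod_equiv e.symm _ _ fun i => rfl

/-! ### Realizable sample sizes: the double sample -/

section DoubleSample

variable {ι : Type*} [Fintype ι] {X : Type u}

open Classical in
/-- The double samples on whose first half some member of `F` agrees with `g`, while it disagrees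
with `g` on at least `k` points of the second half. -/
def doubleBad (ι : Type*) [Fintype ι] (F : Set (Classifier X)) (g : Classifier X) (k : ℕ) :
    Set (Bool × ι → X) :=
  {x | ∃ f ∈ F, (∀ i, f (x (false, i)) = g (x (false, i))) ∧
    k ≤ (Finset.univ.filter fun i => f (x (true, i)) ≠ g (x (true, i))).card}

open Classical in
-- A union bound over traces: swapping leaves the disagreement set on the original points unchanged
-- and only moves its elements between halves.
lemma card_swaps_doubleBad (F : Set (Classifier X)) (g : Classifier X) (k : ℕ)
    (x : Bool × ι → X) :
    (Finset.univ.filter fun σ : ι → Bool => x ∘ swap σ ∈ doubleBad ι F g k).card * 2 ^ k ≤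
      (traces F g x).card * 2 ^ Fintype.card ι := by
  have hsub : (Finset.univ.filter fun σ : ι → Bool => x ∘ swap σ ∈ doubleBad ι F g k) ⊆
      (traces F g x).biUnion fun E => Finset.univ.filter fun σ : ι → Bool =>
        (∀ i, (σ i, i) ∉ E) ∧ k ≤ (Finset.univ.filter fun i => (!σ i, i) ∈ E).card := by
    intro σ hσ
    obtain ⟨f, hf, h1, h2⟩ := (Finset.mem_filter.1 hσ).2
    refine Finset.mem_biUnion.2 ⟨disagreement f g x, ?_, ?_⟩
    · exact Finset.mem_filter.2 ⟨Finset.mem_univ _, f, hf, rfl⟩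
    · refine Finset.mem_filter.2 ⟨Finset.mem_univ _, fun i => ?_, ?_⟩
      · simpa [disagreement, swap] using h1 i
      · simpa [disagreement, swap] using h2
  calc _ ≤ (∑ E ∈ traces F g x, (Finset.univ.filter fun σ : ι → Bool =>
        (∀ i, (σ i, i) ∉ E) ∧ k ≤ (Finset.univ.filter fun i => (!σ i, i) ∈ E).card).card) * 2 ^ k :=
        Nat.mul_le_mul_right _ ((Finset.card_le_card hsub).trans Finset.card_biUnion_le)
    _ ≤ _ := by
        rw [Finset.sum_mul]
        exact Finset.sum_le_card_nsmul _ _ _ fun E _ => card_swaps_mul_two_pow_le E k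

variable [MeasurableSpace X]

lemma WellBehaved.nullMeasurableSet_labelling {F : Set (Classifier X)} (hF : WellBehaved F)
    (μ : Measure X) [IsProbabilityMeasure μ] (b : ι → Bool) :
    NullMeasurableSet {x : ι → X | ∃ f ∈ F, ∀ i, f (x i) = b i} (Measure.pi fun _ => μ) := by
  let e := Fintype.equivFin ι
  have h := (hF.2 _ (b ∘ e.symm) μ inferInstance).preimage
    (measurePreserving_comp_equiv μ e.symm).quasiMeasurePreserving
  convert h using 1
  ext x
  refine exists_congr fun f => and_congr_right fun _ => ?_
  exact ⟨fun h j => h _, fun h j => by simpa using h (e j)⟩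

/-- Once the labels `b` given by `g` are fixed, the trace `E` prescribes the labels of `f`, and
there are finitely many `b`. -/
lemma WellBehaved.nullMeasurableSet_disagreement {F : Set (Classifier X)} (hF : WellBehaved F)
    {g : Classifier X} (hg : Measurable g) (μ : Measure X) [IsProbabilityMeasure μ]
    (E : Finset ι) :
    NullMeasurableSet {x : ι → X | ∃ f ∈ F, disagreement f g x = E} (Measure.pi fun _ => μ) := by
  classical
  have : {x : ι → X | ∃ f ∈ F, disagreement f g x = E} = ⋃ b : ι → Bool,
      {x | ∀ j, g (x j) = b j} ∩ {x | ∃ f ∈ F, ∀ j, f (x j) = (b j ^^ decide (j ∈ E))} := by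
    ext x
    simp only [Set.mem_ofPred_eq, Set.mem_iUnion, Set.mem_inter_iff]
    constructor
    · rintro ⟨f, hf, rfl⟩
      refine ⟨fun j => g (x j), fun j => rfl, f, hf, fun j => ?_⟩
      simp only [disagreement, Finset.mem_filter, Finset.mem_univ, true_and]
      cases f (x j) <;> cases g (x j) <;> rfl
    · rintro ⟨b, hb, f, hf, h⟩
      refine ⟨f, hf, ?_⟩
      ext j
      simp only [disagreement, Finset.mem_filter, Finset.mem_univ, true_and, h j, hb j]
      by_cases hj : j ∈ E <;> cases b j <;> simp [hj]
  rw [this]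
  refine NullMeasurableSet.iUnion fun b => NullMeasurableSet.inter ?_
    (hF.nullMeasurableSet_labelling μ _)
  have : {x : ι → X | ∀ j, g (x j) = b j} = ⋂ j, {x | g (x j) = b j} := by ext; simp
  rw [this]
  exact (MeasurableSet.iInter fun j =>
    (hg.comp (measurable_pi_apply j)) (measurableSet_singleton (b j))).nullMeasurableSet

lemma WellBehaved.nullMeasurableSet_doubleBad {F : Set (Classifier X)} (hF : WellBehaved F)
    {g : Classifier X} (hg : Measurable g) (μ : Measure X) [IsProbabilityMeasure μ] (k : ℕ) :
    NullMeasurableSet (doubleBad ι F g k) (Measure.pi fun _ => μ) := by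
  classical
  have : doubleBad ι F g k = ⋃ E : Finset (Bool × ι), ⋃ _ : (∀ i, (false, i) ∉ E) ∧
      k ≤ (Finset.univ.filter fun i => (true, i) ∈ E).card,
      {x | ∃ f ∈ F, disagreement f g x = E} := by
    ext x
    simp only [doubleBad, Set.mem_ofPred_eq, Set.mem_iUnion]
    constructor
    · rintro ⟨f, hf, h1, h2⟩
      refine ⟨disagreement f g x, ⟨fun i => ?_, ?_⟩, f, hf, rfl⟩
      · simpa [disagreement] using h1 i
      · simpa [disagreement] using h2
    · rintro ⟨E, ⟨h1, h2⟩, f, hf, rfl⟩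
      refine ⟨f, hf, fun i => ?_, ?_⟩
      · simpa [disagreement] using h1 i
      · simpa [disagreement] using h2
  rw [this]
  exact NullMeasurableSet.iUnion fun E => NullMeasurableSet.iUnion fun _ =>
    hF.nullMeasurableSet_disagreement hg μ E

/-- The double sample is bad with small probability: average over the swaps. -/
lemma measureReal_doubleBad_le {F : Set (Classifier X)} {d : ℕ} (hF : WellBehaved F)
    (hd : vcDim F = d) {g : Classifier X} (hg : Measurable g) (μ : Measure X)
    [IsProbabilityMeasure μ] (k : ℕ) {t : ℝ} (ht : 0 < t) (ht1 : t ≤ 1) :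
    (Measure.pi fun _ : Bool × ι => μ).real (doubleBad ι F g k) ≤
      (1 + t) ^ (2 * Fintype.card ι) / t ^ d / 2 ^ k := by
  classical
  set ν := Measure.pi fun _ : Bool × ι => μ
  set B := doubleBad ι F g k
  have hB : NullMeasurableSet B ν := hF.nullMeasurableSet_doubleBad hg μ k
  have hpres (σ : ι → Bool) := measurePreserving_comp_equiv μ (swap σ)
  have hnull (σ : ι → Bool) : NullMeasurableSet ((fun x => x ∘ swap σ) ⁻¹' B) ν :=
    hB.preimage (hpres σ).quasiMeasurePreserving
  have hint (σ : ι → Bool) :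
      Integrable (((fun x => x ∘ swap σ) ⁻¹' B).indicator fun _ => (1 : ℝ)) ν :=
    (integrable_const (1 : ℝ)).indicator₀ (hnull σ)
  -- Every swap preserves `ν`, so each summand is `ν.real B`; pointwise in `x` the same sum counts
  -- bad swaps.
  have hsum : ∑ σ : ι → Bool, ∫ x, ((fun x => x ∘ swap σ) ⁻¹' B).indicator (fun _ => (1 : ℝ)) x ∂ν =
      2 ^ Fintype.card ι * ν.real B := by
    have (σ : ι → Bool) : ∫ x, ((fun x => x ∘ swap σ) ⁻¹' B).indicator (fun _ => (1 : ℝ)) x ∂ν =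
        ν.real B := by
      rw [integral_indicator₀ (hnull σ)]
      simp only [integral_const, smul_eq_mul, mul_one, measureReal_restrict_apply_univ]
      rw [measureReal_def, (hpres σ).measure_preimage hB, measureReal_def]
    simp [this]
  rw [← integral_finsetSum _ fun σ _ => hint σ] at hsum
  have hbound : ∫ x, ∑ σ : ι → Bool, ((fun x => x ∘ swap σ) ⁻¹' B).indicator (fun _ => (1 : ℝ)) x ∂ν ≤
      ∫ _, (1 + t) ^ (2 * Fintype.card ι) / t ^ d * 2 ^ Fintype.card ι / 2 ^ k ∂ν := by
    refine integral_mono (integrable_finsetSum _ fun σ _ => hint σ) (integrable_const _) fun x => ?_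
    have h1 : ∑ σ : ι → Bool, ((fun x => x ∘ swap σ) ⁻¹' B).indicator (fun _ => (1 : ℝ)) x =
        (Finset.univ.filter fun σ : ι → Bool => x ∘ swap σ ∈ B).card := by
      simp [Set.indicator_apply, Finset.sum_boole]
    have h2 := card_traces_mul_pow_le hd g x ht ht1
    have h3 : (((Finset.univ.filter fun σ : ι → Bool => x ∘ swap σ ∈ B).card : ℕ) : ℝ) * 2 ^ k ≤
        (traces F g x).card * 2 ^ Fintype.card ι := by
      exact_mod_cast card_swaps_doubleBad F g k x
    simp only [h1]
    rw [le_div_iff₀ (by positivity)]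
    refine h3.trans ?_
    gcongr
    rw [le_div_iff₀ (by positivity)]
    simpa using h2
  rw [hsum] at hbound
  simp only [integral_const, probReal_univ, one_smul] at hbound
  have h2 : (0 : ℝ) < 2 ^ Fintype.card ι := by positivity
  refine le_of_mul_le_mul_left (hbound.trans (le_of_eq ?_)) h2
  ring

/-- Symmetrization, for outer measures. -/
lemma measure_agree_le {F : Set (Classifier X)} {g : Classifier X} (μ : Measure X)
    [IsProbabilityMeasure μ] (k : ℕ) {ε : ℝ}
    (hk : ∀ f ∈ F, ε < μ.real {x | f x ≠ g x} →
      2⁻¹ ≤ (Measure.pi fun _ : ι => μ) {x | k ≤ hits {x | f x ≠ g x} x}) :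
    (Measure.pi fun _ : ι => μ) {x | ∃ f ∈ F, (∀ i, f (x i) = g (x i)) ∧
      ε < μ.real {x | f x ≠ g x}} ≤
      2 * (Measure.pi fun _ : Bool × ι => μ) (doubleBad ι F g k) := by
  classical
  set P := Measure.pi fun _ : ι => μ
  set ν := Measure.pi fun _ : Bool × ι => μ
  let Φ : (ι → X) × (ι → X) → (Bool × ι → X) := fun p j => bif j.1 then p.2 j.2 else p.1 j.2
  have hΦ : MeasurePreserving Φ (P.prod P) ν := by
    have hm : Measurable Φ := by
      refine measurable_pi_lambda _ fun j => ?_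
      rcases j with ⟨_ | _, i⟩
      · exact (measurable_pi_apply i).comp measurable_fst
      · exact (measurable_pi_apply i).comp measurable_snd
    refine ⟨hm, (Measure.pi_eq fun s hs => ?_).symm⟩
    rw [Measure.map_apply hm (MeasurableSet.univ_pi hs)]
    have : Φ ⁻¹' Set.univ.pi s =
        (Set.univ.pi fun i => s (false, i)) ×ˢ (Set.univ.pi fun i => s (true, i)) := by
      ext p
      simp [Φ, Prod.forall]
    rw [this, Measure.prod_prod, Measure.pi_pi, Measure.pi_pi, Fintype.prod_prod_type,
      Fintype.prod_bool, mul_comm]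
  -- Fubini needs a measurable set; the measurable hull has the same measure.
  set B' := toMeasurable ν (doubleBad ι F g k)
  have hB' : MeasurableSet B' := measurableSet_toMeasurable _ _
  have hsec : Measurable fun x => P (Prod.mk x ⁻¹' (Φ ⁻¹' B')) :=
    measurable_measure_prodMk_left (hΦ.measurable hB')
  -- Markov's inequality for the measure of the section, which is at least 1/2 at every bad first
  -- half.
  have h1 := mul_meas_ge_le_lintegral (μ := P) hsec 2⁻¹
  rw [← Measure.prod_apply (hΦ.measurable hB'), hΦ.measure_preimage hB'.nullMeasurableSet,
    measure_toMeasurable] at h1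
  calc _ ≤ P {x | 2⁻¹ ≤ P (Prod.mk x ⁻¹' (Φ ⁻¹' B'))} := by
        refine measure_mono fun x hx => ?_
        obtain ⟨f, hf, h2, h3⟩ := hx
        refine (hk f hf h3).trans (measure_mono fun x' hx' => ?_)
        refine subset_toMeasurable _ _ ⟨f, hf, h2, ?_⟩
        simpa [hits, Φ] using hx'
    _ = 2 * (2⁻¹ * P {x | 2⁻¹ ≤ P (Prod.mk x ⁻¹' (Φ ⁻¹' B'))}) := by
        rw [← mul_assoc, ENNReal.mul_inv_cancel (by simp) (by simp), one_mul]
    _ ≤ _ := by gcongr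

end DoubleSample

/-! ### Reduction to marginals and the constants of part (a). -/

/-- A realizable distribution reduces to its marginal on the instances. -/
lemma isRealizableSampleSize_of_marginal {X : Type u} [MeasurableSpace X] {F : Set (Classifier X)}
    (hF : ∀ f ∈ F, Measurable f) {ε δ : ℝ} {m : ℕ}
    (h : ∀ (μ : Measure X) [IsProbabilityMeasure μ], ∀ g ∈ F,
      (Measure.pi fun _ : Fin m => μ) {x | ∃ f ∈ F, (∀ i, f (x i) = g (x i)) ∧
        ε < μ.real {x | f x ≠ g x}} ≤ ENNReal.ofReal δ) :
    IsRealizableSampleSize F ε δ m := by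
  rintro D hD ⟨g, hg, hgD⟩
  have hpres : MeasurePreserving (Prod.fst : Example X → X) D (D.map Prod.fst) :=
    ⟨measurable_fst, rfl⟩
  have : IsProbabilityMeasure (D.map (Prod.fst : Example X → X)) :=
    Measure.isProbabilityMeasure_map measurable_fst.aemeasurable
  set μ := D.map (Prod.fst : Example X → X)
  have hpi : MeasurePreserving (fun (S : Fin m → Example X) i => (S i).1) (iid D m)
      (Measure.pi fun _ => μ) := measurePreserving_pi (fun _ => D) (fun _ => μ) fun _ => hpres
  have hae : ∀ᵐ z ∂D, z.2 = g z.1 := by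
    rw [ae_iff]
    exact (measureReal_eq_zero_iff (measure_ne_top _ _)).1 hgD
  have haeS : ∀ᵐ S ∂iid D m, ∀ i, (S i).2 = g (S i).1 := by
    rw [ae_all_iff]
    exact fun i => (Measure.quasiMeasurePreserving_eval (fun _ : Fin m => D) i).ae hae
  refine le_trans ?_ (h μ g hg)
  set A := {x : Fin m → X | ∃ f ∈ F, (∀ i, f (x i) = g (x i)) ∧ ε < μ.real {x | f x ≠ g x}}
  calc _ ≤ iid D m ((fun (S : Fin m → Example X) i => (S i).1) ⁻¹' A) := by
        refine measure_mono_ae ?_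
        filter_upwards [haeS] with S hS hbad
        have hbad' : ¬ ∀ f ∈ F, Perfect (List.ofFn S) f → err D f ≤ ε := hbad
        push Not at hbad'
        obtain ⟨f, hf, h1, h2⟩ := hbad'
        refine ⟨f, hf, fun i => ?_, ?_⟩
        · rw [← hS i]
          exact h1 (S i) (by simp)
        · refine h2.trans_eq ?_
          have hmeas : MeasurableSet {x | f x ≠ g x} :=
            (measurableSet_eq_fun (hF f hf) (hF g hg)).compl
          rw [measureReal_def, hpres.map_eq.symm, Measure.map_apply measurable_fst hmeas]
          refine congrArg ENNReal.toReal (measure_congr ?_)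
          filter_upwards [hae] with z hz
          refine propext ?_
          change z.2 ≠ f z.1 ↔ f z.1 ≠ g z.1
          rw [hz, ne_comm]
    _ ≤ iid D m ((fun (S : Fin m → Example X) i => (S i).1) ⁻¹'
          toMeasurable (Measure.pi fun _ => μ) A) :=
        measure_mono (Set.preimage_mono (subset_toMeasurable _ _))
    _ = _ := by
        rw [hpi.measure_preimage (measurableSet_toMeasurable _ _).nullMeasurableSet,
          measure_toMeasurable]

/-- A numerical lower bound on the probability of at least half the expected number of hits. -/
lemma two_inv_le_measure_hits {X : Type*} [MeasurableSpace X] (μ : Measure X)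
    [IsProbabilityMeasure μ] {B : Set X} (hB : MeasurableSet B) {p : ℝ} (hp : p ≤ μ.real B) {m : ℕ}
    (hm : 5 ≤ p * m) :
    2⁻¹ ≤ (Measure.pi fun _ : Fin m => μ) {x | ⌈p * m / 2⌉₊ ≤ hits B x} := by
  have hmeas : MeasurableSet {x : Fin m → X | ⌈p * m / 2⌉₊ ≤ hits B x} :=
    measurableSet_le measurable_const (measurable_hits B id fun j => measurable_pi_apply j hB)
  -- With `s = 1/2` the exponent is `-(p * m / 2) * (1 - log 2)`, which is below `-log 2` once `p *
  -- m ≥ 5`.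
  have h1 := measureReal_hits_le (ι := Fin m) μ hB (s := 1 / 2) (by norm_num) (by norm_num) hp
    (p * m / 2)
  have hlog : Real.log (1 / 2) = -Real.log 2 := by simp
  have h2 : Real.exp (Fintype.card (Fin m) * p * (1 / 2 - 1) - p * m / 2 * Real.log (1 / 2)) ≤
      2⁻¹ := by
    rw [← Real.exp_log (show (0 : ℝ) < 2⁻¹ by norm_num), Real.log_inv, Fintype.card_fin]
    refine Real.exp_le_exp.2 ?_
    rw [hlog]
    nlinarith [Real.log_two_lt_d9, Real.log_two_gt_d9]
  have h3 : (Measure.pi fun _ : Fin m => μ).real {x | ⌈p * m / 2⌉₊ ≤ hits B x}ᶜ ≤ 2⁻¹ := by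
    refine (measureReal_mono (fun x hx => ?_) (measure_ne_top _ _)).trans (h1.trans h2)
    have : ¬ ⌈p * m / 2⌉₊ ≤ hits B x := hx
    exact (Nat.lt_ceil.1 (not_le.1 this)).le
  rw [measureReal_compl hmeas, probReal_univ] at h3
  rw [← ENNReal.ofReal_toReal (measure_ne_top _ {x : Fin m → X | _}), ← measureReal_def]
  rw [show (2⁻¹ : ENNReal) = ENNReal.ofReal 2⁻¹ by
    rw [ENNReal.ofReal_inv_of_pos (by norm_num)]; simp]
  exact ENNReal.ofReal_le_ofReal (by linarith)

/-- With `t = e/16` the numerator costs only `e * m / 8` in the exponent, against a gain of `(e * m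
/ 2) * log 2`. The difference exceeds `0.2 * e * m`, which by `hm` pays for `d * log (16/e) ≤ 3 * d
* log (1/e)` and for `log 4`. -/
lemma double_sample_bound_le {d m : ℕ} {e : ℝ} (he : 0 < e) (he4 : e ≤ 1 / 4)
    (hm : 20 * (d * Real.log (1 / e) + Real.log 2) ≤ e * m) :
    (1 + e / 16) ^ (2 * m) / (e / 16) ^ d / 2 ^ ⌈e * m / 2⌉₊ ≤ (1 / 4 : ℝ) := by
  have hL : 2 * Real.log 2 ≤ Real.log (1 / e) := by
    rw [← Real.log_rpow (by norm_num)]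
    refine Real.log_le_log (by positivity) ?_
    rw [le_div_iff₀ he]; norm_num; linarith
  have h1 : (1 + e / 16) ^ (2 * m) ≤ Real.exp (2 * m * (e / 16)) := by
    have := pow_le_pow_left₀ (by positivity) (Real.add_one_le_exp (e / 16)) (2 * m)
    rw [← Real.exp_nat_mul, add_comm] at this
    simpa using this
  have h2 : (e / 16) ^ d = Real.exp (-(d * (4 * Real.log 2 + Real.log (1 / e)))) := by
    rw [← Real.exp_log (show 0 < (e / 16) ^ d by positivity), Real.log_pow,
      Real.log_div he.ne' (by norm_num), show (16 : ℝ) = 2 ^ 4 by norm_num, Real.log_pow]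
    simp only [one_div, Real.log_inv]
    push_cast
    ring_nf
  have h3 : Real.exp (e * m / 2 * Real.log 2) ≤ 2 ^ ⌈e * m / 2⌉₊ := by
    rw [← Real.exp_log (show (0 : ℝ) < 2 ^ ⌈e * m / 2⌉₊ by positivity), Real.log_pow]
    exact Real.exp_le_exp.2 (mul_le_mul_of_nonneg_right (Nat.le_ceil _)
      (Real.log_nonneg (by norm_num)))
  have h4 : (1 / 4 : ℝ) = Real.exp (-(2 * Real.log 2)) := by
    rw [Real.exp_neg, ← Real.log_rpow (by norm_num), Real.exp_log (by positivity)]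
    norm_num
  calc _ ≤ Real.exp (2 * m * (e / 16)) /
        Real.exp (-(d * (4 * Real.log 2 + Real.log (1 / e)))) /
        Real.exp (e * m / 2 * Real.log 2) := by rw [h2]; gcongr
    _ = Real.exp (2 * m * (e / 16) + d * (4 * Real.log 2 + Real.log (1 / e)) -
        e * m / 2 * Real.log 2) := by
        rw [← Real.exp_sub, ← Real.exp_sub, sub_neg_eq_add]
    _ ≤ _ := by
        rw [h4]
        refine Real.exp_le_exp.2 ?_
        have h5 : (d : ℝ) * (2 * Real.log 2) ≤ d * Real.log (1 / e) := by gcongr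
        have h6 : 0 ≤ (d : ℝ) * Real.log (1 / e) := by
          have := Real.log_two_gt_d9
          exact mul_nonneg (by positivity) (by linarith)
        have h7 : 0 ≤ e * m * (Real.log 2 - 0.69) :=
          mul_nonneg (by positivity) (by linarith [Real.log_two_gt_d9])
        nlinarith [Real.log_two_gt_d9]

lemma log_one_div_half : Real.log (1 / (1 / 2)) = Real.log 2 := by norm_num

lemma two_mul_log_two_le {ε : ℝ} (hε : 0 < ε) (hε1 : ε < 1) :
    2 * Real.log 2 ≤ Real.log (1 / (ε / 4)) := by
  rw [← Real.log_rpow (by norm_num)]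
  refine Real.log_le_log (by positivity) ?_
  rw [le_div_iff₀ (by positivity)]; norm_num; linarith

lemma one_le_realizableRate {d : ℕ} (hd : 1 ≤ d) {ε : ℝ} (hε : 0 < ε) (hε1 : ε < 1) :
    1 ≤ realizableRate d (ε / 4) (1 / 2) := by
  have h1 := two_mul_log_two_le hε hε1
  have h2 := Real.log_two_gt_d9
  have h3 : (1 : ℝ) ≤ d := by exact_mod_cast hd
  rw [realizableRate, log_one_div_half]
  have h4 : 1 ≤ 1 / (ε / 4) := by rw [le_div_iff₀ (by positivity)]; linarith
  have h5 : 1 ≤ d * Real.log (1 / (ε / 4)) + Real.log 2 := by nlinarith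
  exact one_le_mul_of_one_le_of_one_le h4 h5

/-- A sample size of the order of the realizable rate suffices for a well behaved class. -/
theorem exists_isRealizableSampleSize {X : Type u} [MeasurableSpace X] {F : Set (Classifier X)}
    {d : ℕ} {ε : ℝ} (hF : WellBehaved F) (hd : vcDim F = d) (hd1 : 1 ≤ d) (hε : 0 < ε)
    (hε1 : ε < 1) :
    ∃ m : ℕ, IsRealizableSampleSize F (ε / 4) (1 / 2) m ∧
      (m : ℝ) ≤ 21 * realizableRate d (ε / 4) (1 / 2) := by
  have hR := one_le_realizableRate hd1 hε hε1
  set R := realizableRate d (ε / 4) (1 / 2) with hRdef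
  -- The factor 20 is the one in `double_sample_bound_le`; rounding up adds less than `1 ≤ R`,
  -- whence 21.
  refine ⟨⌈20 * R⌉₊, ?_, ?_⟩
  swap
  · linarith [Nat.ceil_lt_add_one (show 0 ≤ 20 * R by linarith)]
  set m := ⌈20 * R⌉₊
  have hmR : 20 * R ≤ m := Nat.le_ceil _
  set e := ε / 4 with he
  have he0 : 0 < e := by positivity
  have hem : 20 * (d * Real.log (1 / e) + Real.log 2) ≤ e * m := by
    have : e * (20 * R) = 20 * (d * Real.log (1 / e) + Real.log 2) := by
      rw [hRdef, realizableRate, log_one_div_half]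
      field_simp
    rw [← this]
    gcongr
  have h5 : 5 ≤ e * m := by
    refine le_trans ?_ hem
    have h1 := two_mul_log_two_le hε hε1
    rw [← he] at h1
    have h2 := Real.log_two_gt_d9
    have : 0 ≤ (d : ℝ) * Real.log (1 / e) := mul_nonneg (by positivity) (by linarith)
    linarith
  refine isRealizableSampleSize_of_marginal hF.1 fun μ _ g hg => ?_
  refine (measure_agree_le μ ⌈e * m / 2⌉₊ fun f hf hfe => ?_).trans ?_
  · exact two_inv_le_measure_hits μ
      (measurableSet_eq_fun (hF.1 f hf) (hF.1 g hg)).compl hfe.le h5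
  · have h6 := measureReal_doubleBad_le (ι := Fin m) hF hd (hF.1 g hg) μ ⌈e * m / 2⌉₊
      (t := e / 16) (by positivity) (by linarith)
    rw [Fintype.card_fin] at h6
    have h7 := h6.trans (double_sample_bound_le he0 (by linarith) hem)
    rw [← ENNReal.ofReal_toReal (measure_ne_top _ (doubleBad _ _ _ _)), ← measureReal_def,
      show (2 : ENNReal) = ENNReal.ofReal 2 by simp, ← ENNReal.ofReal_mul (by norm_num)]
    exact ENNReal.ofReal_le_ofReal (by linarith)

section

variable {X : Type u}

/-! ### Very small realizable sample sizes -/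

lemma exists_ne_of_one_le_vcDim {F : Set (Classifier X)} {d : ℕ} (hd : vcDim F = d)
    (hd1 : 1 ≤ d) : ∃ f ∈ F, ∃ g ∈ F, ∃ x, f x ≠ g x := by
  have h : (0 : ℕ∞) < vcDim F := by rw [hd]; exact_mod_cast hd1
  obtain ⟨T, hT⟩ := lt_iSup_iff.1 h
  obtain ⟨hT, hpos⟩ := lt_iSup_iff.1 hT
  obtain ⟨x, hx⟩ := Finset.card_pos.1 (by exact_mod_cast hpos : 0 < T.card)
  obtain ⟨f, hf, hfx⟩ := hT fun _ => true
  obtain ⟨g, hg, hgx⟩ := hT fun _ => false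
  exact ⟨f, hf, g, hg, x, by rw [hfx x hx, hgx x hx]; simp⟩

/-- The pairs of a sample and an example that the answer to the sample misclassifies. -/
def misclassified (O : List (Example X) → Option (Classifier X)) (m : ℕ) :
    Set ((Fin m → Example X) × Example X) :=
  {p | ∃ f, O (List.ofFn p.1) = some f ∧ p.2.2 ≠ f p.2.1}

lemma misclassified_section
    {O : List (Example X) → Option (Classifier X)} {m : ℕ}
    {S : Fin m → Example X} {f : Classifier X} (h : O (List.ofFn S) = some f) :
    Prod.mk S ⁻¹' misclassified O m = {z | z.2 ≠ f z.1} := by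
  ext z
  simp [misclassified, h]

/-- The answer to a sample that agrees with `g`. -/
lemma IsRealizableOracle.exists_answer {F : Set (Classifier X)}
    {O : List (Example X) → Option (Classifier X)} {m : ℕ}
    (hO : IsRealizableOracle F O) {g : Classifier X}
    (hg : g ∈ F) {S : Fin m → Example X} (hS : ∀ i, (S i).2 = g (S i).1) :
    ∃ f, O (List.ofFn S) = some f ∧ f ∈ F ∧ Perfect (List.ofFn S) f := by
  obtain ⟨f, hf⟩ := Option.ne_none_iff_exists'.1 (hO.complete (List.ofFn S) ⟨g, hg, fun z hz => by
    obtain ⟨i, rfl⟩ := List.mem_ofFn.1 hz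
    exact (hS i).symm⟩)
  exact ⟨f, hf, hO.sound _ _ hf⟩

variable [MeasurableSpace X]

lemma measurableSet_ne_label {f : Classifier X} (hf : Measurable f) :
    MeasurableSet {z : Example X | z.2 ≠ f z.1} :=
  (measurableSet_eq_fun measurable_snd (hf.comp measurable_fst)).compl

lemma measurableSet_eq_label {f : Classifier X} (hf : Measurable f) :
    MeasurableSet {z : Example X | z.2 = f z.1} :=
  measurableSet_eq_fun measurable_snd (hf.comp measurable_fst)

lemma measure_eq_label (D : Measure (Example X)) [IsProbabilityMeasure D] {f : Classifier X}
    (hf : Measurable f) : D.real {z : Example X | z.2 = f z.1} = 1 - err D f := by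
  have := measureReal_compl (μ := D) (measurableSet_ne_label hf)
  rw [probReal_univ] at this
  rw [err, ← this]
  congr 1
  ext z
  simp

/-- A consistent hypothesis of large error must be ruled out by the sample. -/
lemma IsRealizableSampleSize.pow_le {F : Set (Classifier X)} {ε δ : ℝ} {m : ℕ}
    (h : IsRealizableSampleSize F ε δ m) (D : Measure (Example X)) [IsProbabilityMeasure D]
    {f g : Classifier X} (hf : f ∈ F) (hg : g ∈ F) (hfD : err D f = 0) (hgD : ε < err D g) :
    D {z | z.2 = g z.1} ^ m ≤ ENNReal.ofReal δ := by
  refine le_trans ?_ (h D inferInstance ⟨f, hf, hfD⟩)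
  have : D {z | z.2 = g z.1} ^ m = iid D m (Set.univ.pi fun _ => {z | z.2 = g z.1}) := by
    simp [iid, Measure.pi_pi]
  rw [this]
  refine measure_mono fun S hS hall => ?_
  refine absurd (hall g hg fun z hz => ?_) (not_le.2 hgD)
  obtain ⟨i, rfl⟩ := List.mem_ofFn.1 hz
  exact (hS i (Set.mem_univ _)).symm

/-- Test a realizable sample size on a distribution supported by two points. -/
lemma IsRealizableSampleSize.two_point {F : Set (Classifier X)} (hF : ∀ f ∈ F, Measurable f)
    {ε : ℝ} {m : ℕ} (h : IsRealizableSampleSize F ε (1 / 2) m) (hε : ε < 1 / 3)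
    {f g : Classifier X} (hf : f ∈ F) (hg : g ∈ F) {u : X} (hu : f u ≠ g u) (v : X) :
    m ≠ 0 ∧ (m = 1 → f v ≠ g v) := by
  -- Here `g` has error at least 1/3. If `f` and `g` agreed at `v`, a single example would fail to
  -- expose `g` with probability at least 2/3, more than the allowed 1/2.
  let D : Measure (Example X) := ENNReal.ofReal (2 / 3) • Measure.dirac (v, f v) +
    ENNReal.ofReal (1 / 3) • Measure.dirac (u, f u)
  have hD : IsProbabilityMeasure D := by
    refine ⟨?_⟩
    simp only [D, Measure.add_apply, Measure.smul_apply, measure_univ, smul_eq_mul, mul_one]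
    rw [← ENNReal.ofReal_add (by norm_num) (by norm_num)]
    norm_num
  have happ {s : Set (Example X)} (hs : MeasurableSet s) : D s =
      ENNReal.ofReal (2 / 3) * s.indicator 1 (v, f v) +
      ENNReal.ofReal (1 / 3) * s.indicator 1 (u, f u) := by
    simp [D, Measure.dirac_apply' _ hs]
  have hfD : err D f = 0 := by
    rw [err, measureReal_def, happ (measurableSet_ne_label (hF f hf))]
    simp
  have hgD : ε < err D g := by
    refine hε.trans_le ?_
    have : ENNReal.ofReal (1 / 3) ≤ D {z | z.2 ≠ g z.1} := by
      rw [happ (measurableSet_ne_label (hF g hg)), Set.indicator_of_mem (a := (u, f u))]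
      · simp
      · exact hu
    rw [err, measureReal_def]
    exact (ENNReal.ofReal_le_iff_le_toReal (measure_ne_top _ _)).1 this
  have key := h.pow_le D hf hg hfD hgD
  refine ⟨?_, ?_⟩
  · rintro rfl
    rw [pow_zero, ← ENNReal.ofReal_one] at key
    have := (ENNReal.ofReal_le_ofReal_iff (by norm_num)).1 key
    norm_num at this
  · rintro rfl hv
    have : ENNReal.ofReal (2 / 3) ≤ D {z | z.2 = g z.1} := by
      rw [happ (measurableSet_eq_label (hF g hg)), Set.indicator_of_mem (a := (v, f v))]
      · simp
      · exact hv
    rw [pow_one] at key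
    have := (ENNReal.ofReal_le_ofReal_iff (by norm_num)).1 (this.trans key)
    norm_num at this

/-! ### The oracle as a measurable map -/

/-- The samples whose answer has error at most `θ`. -/
def goodSamples (D : Measure (Example X)) (O : List (Example X) → Option (Classifier X)) (θ : ℝ)
    (m : ℕ) : Set (Fin m → Example X) :=
  {S | ∃ f, O (List.ofFn S) = some f ∧ err D f ≤ θ}

lemma goodSamples_mono (D : Measure (Example X))
    {O : List (Example X) → Option (Classifier X)} {m : ℕ} {θ θ' : ℝ} (h : θ ≤ θ') :
    goodSamples D O θ m ⊆ goodSamples D O θ' m :=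
  fun _ ⟨f, h1, h2⟩ => ⟨f, h1, h2.trans h⟩

section Oracle

variable {O : List (Example X) → Option (Classifier X)} {m : ℕ}

lemma MeasurableOracle.measurableSet_misclassified (hO : MeasurableOracle O) :
    MeasurableSet (misclassified O m) := by
  have : misclassified O m = ⋃ y : Bool,
      ((fun p : (Fin m → Example X) × Example X => (p.1, p.2.1)) ⁻¹'
        {p | ∃ f, O (List.ofFn p.1) = some f ∧ f p.2 = y}) ∩ {p | p.2.2 ≠ y} := by
    ext p
    simp only [misclassified, Set.mem_ofPred_eq, Set.mem_iUnion, Set.mem_inter_iff,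
      Set.mem_preimage]
    constructor
    · rintro ⟨f, h1, h2⟩
      exact ⟨f p.2.1, ⟨f, h1, rfl⟩, h2⟩
    · rintro ⟨y, ⟨f, h1, rfl⟩, h2⟩
      exact ⟨f, h1, h2⟩
  rw [this]
  refine MeasurableSet.iUnion fun y => ((by fun_prop : Measurable
    fun p : (Fin m → Example X) × Example X => (p.1, p.2.1)) (hO m y)).inter ?_
  exact (measurableSet_eq_fun (by fun_prop) measurable_const).compl

/-- The point `x` is a probe: an answer exists exactly when it gives `x` some label. -/
lemma MeasurableOracle.measurableSet_answered (hO : MeasurableOracle O) (x : X) :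
    MeasurableSet {S : Fin m → Example X | ∃ f, O (List.ofFn S) = some f} := by
  have : {S : Fin m → Example X | ∃ f, O (List.ofFn S) = some f} = ⋃ y : Bool,
      (fun S : Fin m → Example X => (S, x)) ⁻¹'
        {p | ∃ f, O (List.ofFn p.1) = some f ∧ f p.2 = y} := by
    ext S
    simp only [Set.mem_ofPred_eq, Set.mem_iUnion, Set.mem_preimage]
    exact ⟨fun ⟨f, h⟩ => ⟨f x, f, h, rfl⟩, fun ⟨_, f, h, _⟩ => ⟨f, h⟩⟩
  rw [this]
  exact MeasurableSet.iUnion fun y => measurable_prodMk_right (hO m y)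

variable (D : Measure (Example X)) [IsProbabilityMeasure D]

/-- The section is the error set of the answer, and is empty when the answer is `none`; hence
`goodSamples` is cut out by this function only among the answered samples. -/
lemma MeasurableOracle.measurable_err (hO : MeasurableOracle O) :
    Measurable fun S : Fin m → Example X => D.real (Prod.mk S ⁻¹' misclassified O m) :=
  (measurable_measure_prodMk_left hO.measurableSet_misclassified).ennreal_toReal

lemma MeasurableOracle.measurableSet_goodSamples (hO : MeasurableOracle O) (x : X) (θ : ℝ) :
    MeasurableSet (goodSamples D O θ m) := by
  have : goodSamples D O θ m = {S | ∃ f, O (List.ofFn S) = some f} ∩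
      {S | D.real (Prod.mk S ⁻¹' misclassified O m) ≤ θ} := by
    ext S
    simp only [goodSamples, Set.mem_ofPred_eq, Set.mem_inter_iff]
    constructor
    · rintro ⟨f, h1, h2⟩
      exact ⟨⟨f, h1⟩, by rw [misclassified_section h1]; exact h2⟩
    · rintro ⟨⟨f, h1⟩, h2⟩
      exact ⟨f, h1, by rw [misclassified_section h1] at h2; exact h2⟩
  rw [this]
  exact (hO.measurableSet_answered x).inter (measurableSet_le (hO.measurable_err D) measurable_const)

end Oracle

/-! ### One round -/

section Round

variable {F : Set (Classifier X)} {O : List (Example X) → Option (Classifier X)} {m : ℕ}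
  (D : Measure (Example X)) [IsProbabilityMeasure D]

/-- Conditioning on agreement with `g`. -/
lemma measure_iid_cond_le {A : Set (Example X)} (hA : D A ≠ 0)
    (G : Set (Fin m → Example X)) :
    D A ^ m * iid (ProbabilityTheory.cond D A) m G ≤ iid D m G := by
  have := ProbabilityTheory.cond_isProbabilityMeasure (μ := D) hA
  have h1 : D.restrict A = D A • ProbabilityTheory.cond D A := by
    rw [ProbabilityTheory.cond, smul_smul, ENNReal.mul_inv_cancel hA (measure_ne_top _ _), one_smul]
  have h2 : (Measure.pi fun _ : Fin m => D.restrict A) =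
      D A ^ m • iid (ProbabilityTheory.cond D A) m := by
    refine Measure.pi_eq fun s _ => ?_
    rw [Measure.smul_apply, iid, Measure.pi_pi, smul_eq_mul, h1]
    simp [Finset.prod_mul_distrib]
  have h3 : (Measure.pi fun _ : Fin m => D.restrict A) ≤ iid D m := by
    rw [← Measure.restrict_pi_pi]
    exact Measure.restrict_le_self
  rw [h2] at h3
  exact h3 G

/-- Errors of `f` outside the agreement set `A` of `g` cost at most `err D g`; inside `A`,
conditioning can only increase the measure. -/
lemma err_le_err_cond_add {f g : Classifier X} (hg : Measurable g) :
    err D f ≤ err (ProbabilityTheory.cond D {z | z.2 = g z.1}) f + err D g := by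
  set A := {z : Example X | z.2 = g z.1}
  have hA : MeasurableSet A := measurableSet_eq_label hg
  have h1 : err D f ≤ D.real (A ∩ {z | z.2 ≠ f z.1}) + err D g := by
    refine (measureReal_mono (fun z hz => ?_) (measure_ne_top _ _)).trans (measureReal_union_le _ _)
    by_cases hzA : z ∈ A
    · exact Or.inl ⟨hzA, hz⟩
    · exact Or.inr hzA
  refine h1.trans (add_le_add_left ?_ _)
  rw [err, measureReal_def, measureReal_def, ProbabilityTheory.cond_apply hA, ENNReal.toReal_mul,
    ENNReal.toReal_inv, ← measureReal_def, ← measureReal_def]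
  by_cases h0 : D.real A = 0
  · have : D.real (A ∩ {z | z.2 ≠ f z.1}) ≤ D.real A :=
      measureReal_mono Set.inter_subset_left (measure_ne_top _ _)
    simpa [h0] using this
  · have h2 : 0 < D.real A := lt_of_le_of_ne measureReal_nonneg (Ne.symm h0)
    exact le_mul_of_one_le_left measureReal_nonneg ((one_le_inv₀ h2).2 measureReal_le_one)

/-- A round succeeds if its sample agrees with `g` and is representative for the
conditional distribution. -/
lemma le_measureReal_goodSamples (hF : ∀ f ∈ F, Measurable f) (hO : IsRealizableOracle F O)
    (hOm : MeasurableOracle O) (x : X) {ε : ℝ} (hm : IsRealizableSampleSize F ε (1 / 2) m)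
    {g : Classifier X} (hg : g ∈ F) (hη : err D g < 1) :
    (1 - err D g) ^ m / 2 ≤ (iid D m).real (goodSamples D O (ε + err D g) m) := by
  set A := {z : Example X | z.2 = g z.1} with hAdef
  have hA : MeasurableSet A := measurableSet_eq_label (hF g hg)
  have hAr : D.real A = 1 - err D g := measure_eq_label D (hF g hg)
  have hA0 : D A ≠ 0 := by
    intro h
    rw [measureReal_def, h, ENNReal.toReal_zero] at hAr
    linarith
  have := ProbabilityTheory.cond_isProbabilityMeasure (μ := D) hA0
  set D' := ProbabilityTheory.cond D A with hD'
  have : IsProbabilityMeasure (iid D' m) := by unfold iid; infer_instance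
  have : IsProbabilityMeasure (iid D m) := by unfold iid; infer_instance
  have hae : ∀ᵐ z ∂D', z ∈ A := ProbabilityTheory.ae_cond_mem hA
  have hgD' : err D' g = 0 := by
    rw [err, measureReal_eq_zero_iff (measure_ne_top _ _)]
    exact ae_iff.1 hae
  have haeS : ∀ᵐ S ∂iid D' m, ∀ i, S i ∈ A := by
    rw [ae_all_iff]
    exact fun i => (Measure.quasiMeasurePreserving_eval (fun _ : Fin m => D') i).ae hae
  set G := goodSamples D O (ε + err D g) m
  have hG : MeasurableSet G := hOm.measurableSet_goodSamples D x _
  have h1 : iid D' m Gᶜ ≤ ENNReal.ofReal (1 / 2) := by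
    refine le_trans (measure_mono_ae ?_) (hm D' inferInstance ⟨g, hg, hgD'⟩)
    filter_upwards [haeS] with S hS hbad hall
    obtain ⟨f, h2, h3, h4⟩ := hO.exists_answer hg hS
    exact hbad ⟨f, h2, (err_le_err_cond_add D (hF g hg)).trans (by gcongr; exact hall f h3 h4)⟩
  have h2 : 1 / 2 ≤ (iid D' m).real G := by
    have h3 := ENNReal.toReal_mono ENNReal.ofReal_ne_top h1
    rw [← measureReal_def, measureReal_compl hG, probReal_univ,
      ENNReal.toReal_ofReal (by norm_num)] at h3
    linarith
  have h3 := ENNReal.toReal_mono (measure_ne_top _ _) (measure_iid_cond_le D hA0 G)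
  rw [ENNReal.toReal_mul, ENNReal.toReal_pow, ← measureReal_def, ← measureReal_def,
    ← measureReal_def, hAr] at h3
  refine le_trans ?_ h3
  have : 0 ≤ (1 - err D g) ^ m := pow_nonneg (by linarith) _
  rw [div_eq_mul_one_div]
  gcongr

/-- If one example is a realizable sample size, then it determines the answer. -/
lemma le_measureReal_goodSamples_one (hF : ∀ f ∈ F, Measurable f) (hO : IsRealizableOracle F O)
    {ε : ℝ} (hε : ε < 1 / 3) (hm : IsRealizableSampleSize F ε (1 / 2) 1)
    {g : Classifier X} (hg : g ∈ F) :
    1 - err D g ≤ (iid D 1).real (goodSamples D O (err D g) 1) := by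
  have : IsProbabilityMeasure (iid D 1) := by unfold iid; infer_instance
  rw [← measure_eq_label D (hF g hg)]
  have h1 : iid D 1 (Set.univ.pi fun _ => {z | z.2 = g z.1}) = D {z | z.2 = g z.1} := by
    simp [iid, Measure.pi_pi]
  rw [measureReal_def, ← h1, ← measureReal_def]
  refine measureReal_mono (fun S hS => ?_) (measure_ne_top _ _)
  have hS' : ∀ i, (S i).2 = g (S i).1 := fun i => hS i (Set.mem_univ _)
  obtain ⟨f, h2, h3, h4⟩ := hO.exists_answer hg hS'
  -- Both agree with the only example, so by `two_point` they cannot be distinct.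
  have hfg : f = g := by
    by_contra hne
    obtain ⟨u, hu⟩ := Function.ne_iff.1 hne
    refine (hm.two_point hF hε h3 hg hu (S 0).1).2 rfl ?_
    rw [h4 (S 0) (by simp), hS' 0]
  exact ⟨f, h2, by rw [hfg]⟩

end Round

/-! ### The success probability of a round -/

lemma exp_neg_two_mul_le {η : ℝ} (h0 : 0 ≤ η) (h1 : η ≤ 1 / 2) : Real.exp (-(2 * η)) ≤ 1 - η := by
  rw [Real.exp_neg, inv_le_iff_one_le_mul₀ (Real.exp_pos _)]
  have := Real.add_one_le_exp (2 * η)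
  nlinarith

/-- The noise rate is small enough for a sample of size `m` to be noise free with
probability `1 / m`. -/
lemma two_mul_err_mul_le_log {d m : ℕ} {ε K η : ℝ} (hd : 1 ≤ d) (hε : 0 < ε) (hε1 : ε < 1)
    (hK : 1 ≤ K) (hη : η ≤ 1 / (32 * K) * ε / d) (hm2 : 2 ≤ m)
    (hm : (m : ℝ) ≤ K * realizableRate d (ε / 4) (1 / 2)) :
    2 * η * m ≤ Real.log m := by
  have hd' : (1 : ℝ) ≤ d := by exact_mod_cast hd
  have hm2' : (2 : ℝ) ≤ m := by exact_mod_cast hm2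
  have hlog2 : Real.log 2 ≤ Real.log m := Real.log_le_log (by norm_num) hm2'
  have hl2 := Real.log_two_gt_d9
  have hη1 : η * m ≤ 1 / (32 * K) * ε / d * m := by gcongr
  -- If `ε * m ≤ 1`, then `η * m ≤ 1/32` already. Otherwise `1/ε ≤ m`, so the logarithm in the rate
  -- is bounded through `log m`; the 32 leaves the factor 1/8 after the 4 from `ε/4`.
  rcases le_or_gt (ε * m) 1 with h | h
  · have h1 : 1 / (32 * K) * ε / d * m ≤ 1 / 32 := by
      rw [div_mul_eq_mul_div, div_le_iff₀ (by positivity), div_mul_eq_mul_div, one_mul,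
        div_mul_eq_mul_div, div_le_iff₀ (by positivity)]
      nlinarith
    linarith
  · have hlogε : Real.log (1 / ε) ≤ Real.log m := by
      refine Real.log_le_log (by positivity) ?_
      rw [div_le_iff₀ hε]; linarith
    have hlog4 : Real.log (1 / (ε / 4)) = 2 * Real.log 2 + Real.log (1 / ε) := by
      rw [show 1 / (ε / 4) = 2 ^ 2 * (1 / ε) by field_simp; norm_num,
        Real.log_mul (by norm_num) (by positivity), Real.log_pow]
      push_cast; ring
    have h1 : 1 / (32 * K) * ε / d * m ≤
        1 / (32 * K) * ε / d * (K * realizableRate d (ε / 4) (1 / 2)) := by gcongr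
    have h2 : 1 / (32 * K) * ε / d * (K * realizableRate d (ε / 4) (1 / 2)) =
        1 / 8 * (Real.log (1 / (ε / 4)) + Real.log 2 / d) := by
      rw [realizableRate, log_one_div_half]
      field_simp
      ring
    have h3 : Real.log 2 / d ≤ Real.log 2 := div_le_self (by linarith) hd'
    linarith

/-- Every round succeeds with probability at least `1 - exp (- 1 / m²)`. -/
lemma measureReal_compl_goodSamples_le {F : Set (Classifier X)}
    {O : List (Example X) → Option (Classifier X)} {m d : ℕ} (D : Measure (Example X))
    [IsProbabilityMeasure D] (hF : ∀ f ∈ F, Measurable f) (hd : vcDim F = d) (hd1 : 1 ≤ d)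
    (hO : IsRealizableOracle F O) (hOm : MeasurableOracle O) {ε K : ℝ} (hε : 0 < ε) (hε1 : ε < 1)
    (hK : 1 ≤ K) (hm : IsRealizableSampleSize F (ε / 4) (1 / 2) m)
    (hmK : (m : ℝ) ≤ K * realizableRate d (ε / 4) (1 / 2)) {g : Classifier X} (hg : g ∈ F)
    (hη : err D g ≤ 1 / (32 * K) * ε / d) :
    m ≠ 0 ∧ (iid D m).real (goodSamples D O (ε / 2) m)ᶜ ≤ Real.exp (-(1 / (m : ℝ) ^ 2)) := by
  have : IsProbabilityMeasure (iid D m) := by unfold iid; infer_instance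
  obtain ⟨f₁, hf₁, f₂, hf₂, x, hx⟩ := exists_ne_of_one_le_vcDim hd hd1
  have hm0 : m ≠ 0 := (hm.two_point hF (by linarith) hf₁ hf₂ hx x).1
  refine ⟨hm0, ?_⟩
  have hη0 : 0 ≤ err D g := measureReal_nonneg
  have hη1 : err D g ≤ ε / 32 := by
    refine hη.trans ?_
    have hd' : (1 : ℝ) ≤ d := by exact_mod_cast hd1
    refine (div_le_self (by positivity) hd').trans ?_
    rw [div_mul_eq_mul_div, one_mul]
    exact div_le_div_of_nonneg_left hε.le (by norm_num) (by linarith)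
  rw [measureReal_compl (hOm.measurableSet_goodSamples D x _), probReal_univ]
  have hmono (θ : ℝ) (hθ : θ ≤ ε / 2) : (iid D m).real (goodSamples D O θ m) ≤
      (iid D m).real (goodSamples D O (ε / 2) m) :=
    measureReal_mono (goodSamples_mono D hθ) (measure_ne_top _ _)
  -- For `m = 1` the general bound allows failure probability 1/2, which is more than `exp (-1)`;
  -- there the answer is `g` itself whenever the example is noise free. For `m ≥ 2`, `1/m² ≤
  -- 1/(2m)`.
  rcases (show m = 1 ∨ 2 ≤ m by omega) with rfl | hm2
  · have h1 := le_measureReal_goodSamples_one D hF hO (by linarith) hm hg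
    have h2 := hmono (err D g) (by linarith)
    have h3 : 1 / 32 ≤ Real.exp (-(1 / ((1 : ℕ) : ℝ) ^ 2)) := by
      norm_num [Real.exp_neg]
      have := Real.exp_one_lt_three
      rw [inv_eq_one_div, div_le_div_iff₀ (by norm_num) (Real.exp_pos _)]
      linarith
    linarith
  · have h1 := le_measureReal_goodSamples D hF hO hOm x hm hg (by linarith)
    have h2 := hmono (ε / 4 + err D g) (by linarith)
    have hm2' : (2 : ℝ) ≤ m := by exact_mod_cast hm2
    have h3 : 1 / (m : ℝ) ≤ (1 - err D g) ^ m := by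
      have h4 := pow_le_pow_left₀ (Real.exp_pos _).le
        (exp_neg_two_mul_le hη0 (by linarith)) m
      refine le_trans ?_ h4
      rw [← Real.exp_nat_mul, ← Real.exp_log (show 0 < 1 / (m : ℝ) by positivity)]
      refine Real.exp_le_exp.2 ?_
      have := two_mul_err_mul_le_log hd1 hε hε1 hK hη hm2 hmK
      rw [one_div, Real.log_inv]
      linarith
    have h5 : 1 / (m : ℝ) ^ 2 ≤ 1 / m / 2 := by
      rw [div_div, div_le_div_iff₀ (by positivity) (by positivity)]
      nlinarith
    have h6 := Real.add_one_le_exp (-(1 / (m : ℝ) ^ 2))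
    linarith

end

/-! ### The run of the algorithm -/

namespace OracleProg

variable {Q A R : Type u} (O : Q → A) (k : List A → OracleProg Q A R)

lemma result_callAll (qs : List Q) (acc : List A) :
    (callAll k qs acc).result O = (k (acc.reverse ++ qs.map O)).result O := by
  induction qs generalizing acc with
  | nil => simp [callAll]
  | cons q qs ih => simp [callAll, result, ih]

lemma calls_callAll (qs : List Q) (acc : List A) :
    (callAll k qs acc).calls O = (k (acc.reverse ++ qs.map O)).calls O + qs.length := by
  induction qs generalizing acc with
  | nil => simp [callAll]
  | cons q qs ih => simp [callAll, calls, ih]; ring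

end OracleProg

variable {X : Type u} {r m n : ℕ}

lemma calls_algorithm (O : List (Example X) → Option (Classifier X)) (ω : Draw X r m n) :
    (algorithm ω).calls O = r := by
  simp [algorithm, learner, OracleProg.calls_callAll, OracleProg.calls]

lemma result_algorithm (O : List (Example X) → Option (Classifier X)) (ω : Draw X r m n) :
    (algorithm ω).result O =
      minimizers (List.ofFn ω.2) (List.ofFn fun i => O (List.ofFn (ω.1 i))) := by
  simp [algorithm, learner, OracleProg.result_callAll, OracleProg.result, List.map_ofFn,
    Function.comp_def]

lemma countP_ofFn_eq_hits (p : Example X → Prop) [DecidablePred p] (S : Fin n → Example X) :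
    (List.ofFn S).countP (fun z => p z) = hits {z | p z} S := by
  classical
  simp only [hits, Finset.card_filter, Set.mem_ofPred_eq]
  induction n with
  | zero => simp
  | succ n ih =>
    rw [List.ofFn_succ, List.countP_cons, ih, Fin.sum_univ_succ, add_comm]
    simp only [decide_eq_true_eq]

lemma empErr_ofFn (S : Fin n → Example X) (f : Classifier X) :
    empErr (List.ofFn S) f = hits {z | z.2 ≠ f z.1} S / n := by
  rw [empErr, countP_ofFn_eq_hits, List.length_ofFn]

lemma minimizers_nonempty (S : List (Example X)) {answers : List (Option (Classifier X))}
    {f : Classifier X} (hf : some f ∈ answers) : (minimizers S answers).Nonempty := by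
  have hfin : {g : Classifier X | some g ∈ answers}.Finite :=
    (List.finite_toSet answers).preimage (Option.some_injective _).injOn
  obtain ⟨g, hg, hmin⟩ := Set.exists_min_image _ (empErr S) hfin ⟨f, hf⟩
  exact ⟨g, hg, hmin⟩

variable [MeasurableSpace X]

/-! ### Selection by the fresh sample. -/

/-- The draws for which the fresh sample misjudges the answer of round `i`. -/
def misjudged (D : Measure (Example X)) (O : List (Example X) → Option (Classifier X)) (ε : ℝ)
    (r m n : ℕ) (i : Fin r) : Set (Draw X r m n) :=
  {ω | ∃ f, O (List.ofFn (ω.1 i)) = some f ∧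
    ((ε < err D f ∧ (hits {z | z.2 ≠ f z.1} ω.2 : ℝ) ≤ 3 / 4 * ε * n) ∨
      (err D f ≤ ε / 2 ∧ 3 / 4 * ε * n ≤ (hits {z | z.2 ≠ f z.1} ω.2 : ℝ)))}

/-- The good answer makes fewer than `3/4 * ε * n` mistakes and every answer of error above `ε`
makes more, so no minimizer is bad. With one round the only answer is the good one, and the fresh
sample is irrelevant. -/
lemma succeeds_of_not_misjudged {D : Measure (Example X)}
    {O : List (Example X) → Option (Classifier X)} {ε : ℝ} (hε : 0 < ε) {ω : Draw X r m n}
    (hn : 2 ≤ r → 0 < n) {i₀ : Fin r} (h₀ : ω.1 i₀ ∈ goodSamples D O (ε / 2) m)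
    (h : 2 ≤ r → ∀ i, ω ∉ misjudged D O ε r m n i) : Succeeds D O ε ω := by
  obtain ⟨f₀, hf₀, herr₀⟩ := h₀
  have hmem : some f₀ ∈ List.ofFn fun i => O (List.ofFn (ω.1 i)) := List.mem_ofFn.2 ⟨i₀, hf₀⟩
  rw [Succeeds, result_algorithm]
  refine ⟨minimizers_nonempty _ hmem, fun f hf => ?_⟩
  obtain ⟨hf, hmin⟩ := hf
  obtain ⟨i, hi⟩ := List.mem_ofFn.1 hf
  by_cases hr : 2 ≤ r
  · by_contra! hbad
    have h1 : ¬ (hits {z | z.2 ≠ f z.1} ω.2 : ℝ) ≤ 3 / 4 * ε * n := fun hle =>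
      h hr i ⟨f, hi, Or.inl ⟨hbad, hle⟩⟩
    have h2 : ¬ 3 / 4 * ε * n ≤ (hits {z | z.2 ≠ f₀ z.1} ω.2 : ℝ) := fun hle =>
      h hr i₀ ⟨f₀, hf₀, Or.inr ⟨herr₀, hle⟩⟩
    have h3 := hmin f₀ hmem
    -- For `n = 0` all empirical errors would be `0 / 0 = 0` and the comparison would be void.
    have hn' : (0 : ℝ) < n := by exact_mod_cast hn hr
    rw [empErr_ofFn, empErr_ofFn, div_le_div_iff_of_pos_right hn'] at h3
    linarith
  · have : i = i₀ := by
      apply Fin.ext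
      have := i.2
      have := i₀.2
      omega
    rw [this, hf₀, Option.some.injEq] at hi
    rw [← hi]
    linarith

variable (D : Measure (Example X)) [IsProbabilityMeasure D]

/-- Both the error and the number of mistakes of the answer are read off the jointly measurable set
`misclassified`, without a measurable structure on classifiers. -/
lemma MeasurableOracle.measurableSet_misjudged {O : List (Example X) → Option (Classifier X)}
    (hO : MeasurableOracle O) (x : X) (ε : ℝ) (i : Fin r) :
    MeasurableSet (misjudged D O ε r m n i) := by
  let e : Draw X r m n → ℝ := fun ω => D.real (Prod.mk (ω.1 i) ⁻¹' misclassified O m)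
  let c : Draw X r m n → ℝ := fun ω => hits (misclassified O m) fun j => (ω.1 i, ω.2 j)
  have hproj : Measurable fun ω : Draw X r m n => ω.1 i := by fun_prop
  have he : Measurable e := (hO.measurable_err D).comp hproj
  have hc : Measurable c := by
    refine measurable_from_nat.comp (measurable_hits _ _ fun j => ?_)
    exact (by fun_prop : Measurable fun ω : Draw X r m n => (ω.1 i, ω.2 j))
      hO.measurableSet_misclassified
  have hc' {ω : Draw X r m n} {f : Classifier X} (hf : O (List.ofFn (ω.1 i)) = some f) :
      c ω = hits {z | z.2 ≠ f z.1} ω.2 := by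
    rw [← misclassified_section hf]
    rfl
  have he' {ω : Draw X r m n} {f : Classifier X} (hf : O (List.ofFn (ω.1 i)) = some f) :
      e ω = err D f := by
    simp only [e, misclassified_section hf, err]
  have : misjudged D O ε r m n i =
      ((fun ω : Draw X r m n => ω.1 i) ⁻¹' {S | ∃ f, O (List.ofFn S) = some f}) ∩
      (({ω | ε < e ω} ∩ {ω | c ω ≤ 3 / 4 * ε * n}) ∪
        ({ω | e ω ≤ ε / 2} ∩ {ω | 3 / 4 * ε * n ≤ c ω})) := by
    ext ω
    simp only [misjudged, Set.mem_ofPred_eq, Set.mem_inter_iff, Set.mem_union, Set.mem_preimage]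
    constructor
    · rintro ⟨f, hf, h⟩
      rw [hc' hf, he' hf]
      exact ⟨⟨f, hf⟩, h⟩
    · rintro ⟨⟨f, hf⟩, h⟩
      rw [hc' hf, he' hf] at h
      exact ⟨f, hf, h⟩
  rw [this]
  refine (hproj (hO.measurableSet_answered x)).inter (MeasurableSet.union ?_ ?_)
  · exact (measurableSet_lt measurable_const he).inter (measurableSet_le hc measurable_const)
  · exact (measurableSet_le he measurable_const).inter (measurableSet_le measurable_const hc)

/-- Divided by `ε * n`, the Chernoff exponents at the threshold 3/4 are `1/4 - 3/4 * log (3/2)` for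
mean 1/2 and `-1/4 - 3/4 * log (3/4)` for mean 1. These bounds make both at most `-1/50`. -/
lemma log_three_halves_bounds :
    27 / 100 ≤ 3 / 4 * Real.log (3 / 2) ∧ 3 / 4 * -Real.log (3 / 4) ≤ 23 / 100 := by
  constructor
  · have h : (36 / 100 : ℝ) ≤ Real.log (3 / 2) := by
      rw [Real.le_log_iff_exp_le (by norm_num)]
      have h1 : Real.exp (36 / 100) ^ 25 ≤ (3 / 2 : ℝ) ^ 25 := by
        rw [← Real.exp_nat_mul]
        have : ((25 : ℕ) : ℝ) * (36 / 100) = (9 : ℕ) * 1 := by norm_num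
        rw [this, Real.exp_nat_mul]
        exact (pow_le_pow_left₀ (Real.exp_pos _).le Real.exp_one_lt_d9.le 9).trans (by norm_num)
      exact le_of_pow_le_pow_left₀ (by norm_num) (by norm_num) h1
    linarith
  · have h : -Real.log (3 / 4) ≤ (30 / 100 : ℝ) := by
      rw [← Real.log_inv, Real.log_le_iff_le_exp (by norm_num)]
      have h1 : ((3 / 4 : ℝ)⁻¹) ^ 10 ≤ Real.exp (30 / 100) ^ 10 := by
        rw [← Real.exp_nat_mul]
        have : ((10 : ℕ) : ℝ) * (30 / 100) = (3 : ℕ) * 1 := by norm_num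
        rw [this, Real.exp_nat_mul]
        exact le_trans (by norm_num)
          (pow_le_pow_left₀ (by norm_num) Real.exp_one_gt_d9.le 3)
      exact le_of_pow_le_pow_left₀ (by norm_num) (Real.exp_pos _).le h1
    linarith

/-- With the training samples fixed, the answer is one fixed classifier and the fresh sample is
independent of it. Chernoff applies with `s` equal to the threshold divided by the bound on the
mean. -/
lemma measure_misjudged_le {F : Set (Classifier X)} {O : List (Example X) → Option (Classifier X)}
    (hF : ∀ f ∈ F, Measurable f) (hO : IsRealizableOracle F O) (hOm : MeasurableOracle O) (x : X)
    {ε : ℝ} (hε : 0 < ε) (i : Fin r) :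
    drawLaw D r m n (misjudged D O ε r m n i) ≤ ENNReal.ofReal (Real.exp (-(ε * n / 50))) := by
  have : IsProbabilityMeasure (iid D m) := by unfold iid; infer_instance
  have : IsProbabilityMeasure (iid D n) := by unfold iid; infer_instance
  have hεn : 0 ≤ ε * n := by positivity
  obtain ⟨hlog1, hlog2⟩ := log_three_halves_bounds
  rw [drawLaw, Measure.prod_apply (hOm.measurableSet_misjudged D x ε i)]
  refine (lintegral_mono (g := fun _ => ENNReal.ofReal (Real.exp (-(ε * n / 50))))
    fun τ => ?_).trans (by simp)
  rcases hτ : O (List.ofFn (τ i)) with _ | f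
  · have : Prod.mk τ ⁻¹' misjudged D O ε r m n i = ∅ := by
      ext S; simp [misjudged, hτ]
    simp [this]
  have hB := measurableSet_ne_label (hF f (hO.sound _ _ hτ).1)
  rw [← ENNReal.ofReal_toReal (measure_ne_top _ _), ← measureReal_def]
  refine ENNReal.ofReal_le_ofReal ?_
  rcases le_or_gt (err D f) ε with h | h
  · rcases le_or_gt (err D f) (ε / 2) with h2 | h2
    · refine (measureReal_mono (s₂ := {z | 3 / 4 * ε * n ≤ (hits {z | z.2 ≠ f z.1} z : ℝ)}) ?_
        (measure_ne_top _ _)).trans ((measureReal_le_hits (ι := Fin n) D hB (s := 3 / 2)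
          (by norm_num) h2 (3 / 4 * ε * n)).trans (Real.exp_le_exp.2 ?_))
      · rintro S ⟨g, hg, h3⟩
        rw [hτ, Option.some.injEq] at hg
        subst hg
        rcases h3 with h3 | h3
        · exact absurd h3.1 (not_lt.2 h)
        · exact h3.2
      · rw [Fintype.card_fin]
        nlinarith
    · have : Prod.mk τ ⁻¹' misjudged D O ε r m n i = ∅ := by
        ext S
        simp [misjudged, hτ, h2, h]
      simp only [this, measureReal_empty]
      positivity
  · refine (measureReal_mono (s₂ := {z | (hits {z | z.2 ≠ f z.1} z : ℝ) ≤ 3 / 4 * ε * n}) ?_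
      (measure_ne_top _ _)).trans ((measureReal_hits_le (ι := Fin n) D hB (s := 3 / 4)
        (by norm_num) (by norm_num) h.le (3 / 4 * ε * n)).trans (Real.exp_le_exp.2 ?_))
    · rintro S ⟨g, hg, h3⟩
      rw [hτ, Option.some.injEq] at hg
      subst hg
      rcases h3 with h3 | h3
      · exact h3.2
      · linarith [h3.1]
    · rw [Fintype.card_fin]
      nlinarith

lemma measure_forall_not_good_le {O : List (Example X) → Option (Classifier X)} {θ q : ℝ}
    (hq : (iid D m).real (goodSamples D O θ m)ᶜ ≤ q) :
    drawLaw D r m n {ω | ∀ i, ω.1 i ∉ goodSamples D O θ m} ≤ ENNReal.ofReal (q ^ r) := by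
  have : IsProbabilityMeasure (iid D m) := by unfold iid; infer_instance
  have : IsProbabilityMeasure (iid D n) := by unfold iid; infer_instance
  have h1 : {ω : Draw X r m n | ∀ i, ω.1 i ∉ goodSamples D O θ m} =
      (Set.univ.pi fun _ => (goodSamples D O θ m)ᶜ) ×ˢ Set.univ := by
    ext ω; simp [Set.mem_pi]
  have hq0 : 0 ≤ q := measureReal_nonneg.trans hq
  rw [h1, drawLaw, Measure.prod_prod, Measure.pi_pi, measure_univ, mul_one, Finset.prod_const,
    Finset.card_univ, Fintype.card_fin, ENNReal.ofReal_pow hq0]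
  gcongr
  rw [← ENNReal.ofReal_toReal (measure_ne_top _ (goodSamples D O θ m)ᶜ), ← measureReal_def]
  exact ENNReal.ofReal_le_ofReal hq

/-- All rounds fail with probability at most `δ / 2`. -/
lemma exp_pow_rounds_le {δ : ℝ} (hδ : 0 < δ) (hm : m ≠ 0) :
    Real.exp (-(1 / (m : ℝ) ^ 2)) ^ rounds m δ ≤ δ / 2 := by
  have hm' : (0 : ℝ) < m := by positivity
  rw [← Real.exp_nat_mul, ← Real.exp_log (show 0 < δ / 2 by positivity)]
  refine Real.exp_le_exp.2 ?_
  have h1 : (m : ℝ) ^ 2 * Real.log (2 / δ) ≤ rounds m δ := Nat.le_ceil _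
  have h2 : Real.log (2 / δ) = -Real.log (δ / 2) := by
    rw [← Real.log_inv, inv_div]
  rw [h2] at h1
  rw [mul_neg, mul_one_div, neg_le_iff_add_nonneg, add_comm, ← neg_le_iff_add_nonneg,
    le_div_iff₀ (by positivity)]
  linarith

/-- The fresh sample misjudges one of the answers with probability at most `δ / 2`. -/
lemma mul_exp_freshSize_le {C ε δ : ℝ} (hε : 0 < ε) (hδ : 0 < δ) (hδ1 : δ < 1) (hC : 100 ≤ C)
    (hr : 2 ≤ r) :
    0 < freshSize C ε δ r ∧ r * Real.exp (-(ε * freshSize C ε δ r / 50)) ≤ δ / 2 := by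
  have hr' : (2 : ℝ) ≤ r := by exact_mod_cast hr
  have hr0 : (0 : ℝ) < r := by linarith
  have hlog : 0 < Real.log (r / δ) := Real.log_pos (by rw [lt_div_iff₀ hδ]; linarith)
  have hC0 : 0 < C := by linarith
  refine ⟨Nat.ceil_pos.2 (by positivity), ?_⟩
  have h1 : C / ε * Real.log (r / δ) ≤ freshSize C ε δ r := Nat.le_ceil _
  -- `C ≥ 100 = 2 * 50` squares the failure bound: the union bound gives `r * (δ/r)² = δ²/r`, at
  -- most `δ/2` because `r ≥ 2`.
  have h2 : 2 * Real.log (r / δ) ≤ ε * freshSize C ε δ r / 50 := by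
    rw [le_div_iff₀ (by norm_num)]
    calc 2 * Real.log (r / δ) * 50 ≤ C * Real.log (r / δ) := by nlinarith
      _ = ε * (C / ε * Real.log (r / δ)) := by field_simp
      _ ≤ _ := by gcongr
  have h3 : Real.exp (-(2 * Real.log (r / δ))) = (δ / r) ^ 2 := by
    rw [← Real.exp_log (show 0 < (δ / r) ^ 2 by positivity), Real.log_pow,
      ← inv_div, Real.log_inv]
    push_cast
    ring_nf
  calc r * Real.exp (-(ε * freshSize C ε δ r / 50)) ≤ r * (δ / r) ^ 2 := by
        rw [← h3]; gcongr
    _ = δ ^ 2 / r := by field_simp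
    _ ≤ δ / 2 := by
        rw [div_le_div_iff₀ hr0 (by norm_num)]
        nlinarith

/-- The success probability of the algorithm. -/
theorem drawLaw_not_succeeds_le {F : Set (Classifier X)}
    {O : List (Example X) → Option (Classifier X)} (hF : ∀ f ∈ F, Measurable f)
    (hO : IsRealizableOracle F O) (hOm : MeasurableOracle O) (x : X) {ε δ C : ℝ} (hε : 0 < ε)
    (hδ : 0 < δ) (hδ1 : δ < 1) (hC : 100 ≤ C) (hm : m ≠ 0)
    (hgood : (iid D m).real (goodSamples D O (ε / 2) m)ᶜ ≤ Real.exp (-(1 / (m : ℝ) ^ 2))) :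
    drawLaw D (rounds m δ) m (freshSize C ε δ (rounds m δ)) {ω | ¬ Succeeds D O ε ω} ≤
      ENNReal.ofReal δ := by
  set r := rounds m δ with hr
  set n := freshSize C ε δ r
  set E₁ : Set (Draw X r m n) := {ω | ∀ i, ω.1 i ∉ goodSamples D O (ε / 2) m}
  have hE₁ : drawLaw D r m n E₁ ≤ ENNReal.ofReal (δ / 2) :=
    (measure_forall_not_good_le D hgood).trans
      (ENNReal.ofReal_le_ofReal (exp_pow_rounds_le hδ hm))
  by_cases hr2 : 2 ≤ r
  · obtain ⟨hn, hexp⟩ := mul_exp_freshSize_le hε hδ hδ1 hC hr2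
    have hsub : {ω | ¬ Succeeds D O ε ω} ⊆ E₁ ∪ ⋃ i, misjudged D O ε r m n i := by
      intro ω hω
      by_contra hcon
      simp only [Set.mem_union, not_or, Set.mem_iUnion, not_exists] at hcon
      obtain ⟨h1, h2⟩ := hcon
      simp only [E₁, Set.mem_ofPred_eq, not_forall, not_not] at h1
      obtain ⟨i₀, h1⟩ := h1
      exact hω (succeeds_of_not_misjudged hε (fun _ => hn) h1 fun _ => h2)
    refine (measure_mono hsub).trans ((measure_union_le _ _).trans ?_)
    have hδ2 : ENNReal.ofReal δ = ENNReal.ofReal (δ / 2) + ENNReal.ofReal (δ / 2) := by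
      rw [← ENNReal.ofReal_add (by positivity) (by positivity), add_halves]
    rw [hδ2]
    refine add_le_add hE₁ ((measure_iUnion_fintype_le _ _).trans ?_)
    refine (Finset.sum_le_card_nsmul _ _ _ fun i _ =>
      measure_misjudged_le D hF hO hOm x hε i).trans ?_
    rw [Finset.card_univ, Fintype.card_fin, nsmul_eq_mul, ← ENNReal.ofReal_natCast,
      ← ENNReal.ofReal_mul (by positivity)]
    exact ENNReal.ofReal_le_ofReal hexp
  · refine (measure_mono fun ω hω => ?_).trans
      (hE₁.trans (ENNReal.ofReal_le_ofReal (by linarith)))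
    by_contra h1
    simp only [E₁, Set.mem_ofPred_eq, not_forall, not_not] at h1
    obtain ⟨i₀, h1⟩ := h1
    exact hω (succeeds_of_not_misjudged hε (fun h => absurd h hr2) h1 fun h => absurd h hr2)

/-! ### The number of calls -/

/-- A polynomial bound on the number of rounds. -/
def callBound (K : ℝ) : MvPolynomial (Fin 3) ℝ :=
  (MvPolynomial.C (4 * K) * MvPolynomial.X 1 *
    (MvPolynomial.C 4 * MvPolynomial.X 0 * MvPolynomial.X 1 + 1)) ^ 2 *
    (1 + MvPolynomial.X 2) + 1

lemma rounds_le_callBound {d m : ℕ} {ε δ K : ℝ} (hε : 0 < ε) (hδ : 0 < δ)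
    (hδ1 : δ < 1) (hK : 0 ≤ K) (hm : (m : ℝ) ≤ K * realizableRate d (ε / 4) (1 / 2)) :
    (rounds m δ : ℝ) ≤
      MvPolynomial.eval ![(d : ℝ), 1 / ε, Real.log (1 / δ)] (callBound K) := by
  have hlog2 : Real.log 2 ≤ 1 := by linarith [Real.log_two_lt_d9]
  have hlogδ : 0 ≤ Real.log (1 / δ) := Real.log_nonneg (by rw [le_div_iff₀ hδ]; linarith)
  have hlog : Real.log (2 / δ) ≤ 1 + Real.log (1 / δ) := by
    rw [← mul_one_div, Real.log_mul (by norm_num) (by positivity)]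
    linarith
  have hlog0 : 0 ≤ Real.log (2 / δ) := Real.log_nonneg (by rw [le_div_iff₀ hδ]; linarith)
  -- The logarithm is removed by `log y ≤ y` at `y = 4/ε`.
  have hR : realizableRate d (ε / 4) (1 / 2) ≤ 4 * (1 / ε) * (4 * d * (1 / ε) + 1) := by
    rw [realizableRate, log_one_div_half, show 1 / (ε / 4) = 4 * (1 / ε) by field_simp]
    have h1 : Real.log (4 * (1 / ε)) ≤ 4 * (1 / ε) :=
      (Real.log_le_sub_one_of_pos (by positivity)).trans (by linarith)
    have h2 : (d : ℝ) * Real.log (4 * (1 / ε)) ≤ d * (4 * (1 / ε)) := by gcongr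
    exact mul_le_mul_of_nonneg_left (by linarith) (by positivity)
  have hm' : (m : ℝ) ≤ 4 * K * (1 / ε) * (4 * d * (1 / ε) + 1) :=
    hm.trans ((mul_le_mul_of_nonneg_left hR hK).trans_eq (by ring))
  have h1 : (rounds m δ : ℝ) ≤ (m : ℝ) ^ 2 * Real.log (2 / δ) + 1 :=
    (Nat.ceil_lt_add_one (by positivity)).le
  refine h1.trans ?_
  simp only [callBound, map_add, map_mul, map_pow, map_one, MvPolynomial.eval_C,
    MvPolynomial.eval_X, Matrix.cons_val]
  gcongr

end SmallNoise

end

open SmallNoise in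
theorem mainTheorem6 :
    (∃ K₀ : ℝ, ∀ (X : Type u) [MeasurableSpace X] (F : Set (Classifier X)) (d : ℕ) (ε : ℝ),
      WellBehaved F → vcDim F = d → 1 ≤ d → 0 < ε → ε < 1 →
      ∃ m : ℕ, IsRealizableSampleSize F (ε / 4) (1 / 2) m ∧
        (m : ℝ) ≤ K₀ * realizableRate d (ε / 4) (1 / 2)) ∧
    (∃ C₀ : ℝ, ∀ K : ℝ, ∃ c : ℝ, 0 < c ∧ ∃ P : MvPolynomial (Fin 3) ℝ,
      ∀ (X : Type u) [MeasurableSpace X] (F : Set (Classifier X)) (d : ℕ)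
        (D : Measure (Example X)) [IsProbabilityMeasure D]
        (O : List (Example X) → Option (Classifier X)) (ε δ C : ℝ) (m : ℕ),
        (∀ f ∈ F, Measurable f) → vcDim F = d → 1 ≤ d →
        IsRealizableOracle F O → MeasurableOracle O →
        0 < ε → ε < 1 → 0 < δ → δ < 1 → C₀ ≤ C →
        IsRealizableSampleSize F (ε / 4) (1 / 2) m →
        (m : ℝ) ≤ K * realizableRate d (ε / 4) (1 / 2) →
        (∃ f ∈ F, err D f ≤ c * ε / d) →
        (∀ ω : Draw X (rounds m δ) m (freshSize C ε δ (rounds m δ)),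
          ((algorithm ω).calls O : ℝ) ≤
            MvPolynomial.eval ![(d : ℝ), 1 / ε, Real.log (1 / δ)] P) ∧
        drawLaw D (rounds m δ) m (freshSize C ε δ (rounds m δ))
          {ω | ¬ Succeeds D O ε ω} ≤ ENNReal.ofReal δ) := by
  refine ⟨⟨21, fun X _ F d ε hF hd hd1 hε hε1 =>
    exists_isRealizableSampleSize hF hd hd1 hε hε1⟩, 100, fun K => ?_⟩
  -- The maximum keeps `c` positive for every real `K` and only weakens the bound on `m`.
  refine ⟨1 / (32 * max K 1), by positivity, callBound (max K 1), ?_⟩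
  rintro X _ F d D _ O ε δ C m hF hd hd1 hO hOm hε hε1 hδ hδ1 hC hm hmK ⟨g, hg, hη⟩
  have hR : 0 ≤ realizableRate d (ε / 4) (1 / 2) :=
    zero_le_one.trans (one_le_realizableRate hd1 hε hε1)
  have hmK' : (m : ℝ) ≤ max K 1 * realizableRate d (ε / 4) (1 / 2) :=
    hmK.trans (mul_le_mul_of_nonneg_right (le_max_left _ _) hR)
  -- Positive VC dimension supplies the probe point used for measurability.
  obtain ⟨-, -, -, -, x, -⟩ := exists_ne_of_one_le_vcDim hd hd1
  obtain ⟨hm0, hgood⟩ := measureReal_compl_goodSamples_le D hF hd hd1 hO hOm hε hε1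
    (le_max_right K 1) hm hmK' hg hη
  refine ⟨fun ω => ?_, drawLaw_not_succeeds_le D hF hO hOm x hε hδ hδ1 hC hm0 hgood⟩
  rw [calls_algorithm]
  exact rounds_le_callBound hε hδ hδ1 (by positivity) hmK'
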